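/- Let $\Bbbk$ be a field and let $G$ be a finite simple graph without isolated vertices. Let $S=\Bbbk[v : v\in V(G)]$, with homogeneous maximal ideal $\mathfrak m$, and let $I(G)=(vw : \{v,w\}\in E(G))\subseteq S$ be the edge ideal of $G$. For $n\ge 1$, let $I(G)^{[n]}$ be the ideal generated by the squarefree monomials belonging to $I(G)^n$ (the $n$-th squarefree power). Let $m(G)$ be the matching number of $G$, i.e. the maximum number of edges of a matching of $G$. For a monomial ideal $I\subseteq S$ with minimal set of monomial generators $\mathcal G(I)$, the Taylor complex of $S/I$ is the complex of free $S$-modules with basis $\{e_\sigma : \sigma\subseteq \mathcal G(I)\}$, $e_\sigma$ in homological degree $|\sigma|$, and differential $$\partial(e_\sigma)=\sum_{j=1}^{t}(-1)^{j+1}\,\frac{\operatorname{lcm}(\sigma)}{\operatorname{lcm}(\sigma\setminus\{m_{j}\})}\,e_{\sigma\setminus\{m_{j}\}}\qquad(\sigma=\{m_1,\dots,m_t\}),$$ where the elements of each $\sigma$ are listed according to a fixed total order of the monomials. The Scarf complex of $S/I$ is its subcomplex spanned by those $e_\sigma$ for which $\operatorname{lcm}(\tau)\neq\operatorname{lcm}(\sigma)$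 for every $\tau\subseteq\mathcal G(I)$ with $\tau\ne\sigma$. The ideal $I$ is called Taylor (respectively Scarf) if its Taylor complex (respectively Scarf complex) is a minimal free resolution of $S/I$, i.e. its homology is isomorphic to $S/I$ in degree $0$ and vanishes in positive degrees, and the image of its differential is contained in $\mathfrak m$ times the complex. Let $n$ be an integer with $2\le n\le m(G)$. Then the following statements are equivalent. 1. $I(G)^{[n]}$ is Scarf. 2. $I(G)^{[n]}$ is Taylor. 3. Either $G$ has a perfect matching of size $n$, or the vertex set of $G$ can be labelled as $V(G)=\{x_1,\dots,x_{2n},y_1,\dots,y_\ell\}$ (all $2n+\ell$ vertices distinct) for some $\ell\ge 1$ such that $\{x_1x_2,x_3x_4,\dots,x_{2n-1}x_{2n}\}$ is a matching of $G$ and each of the vertices $x_{2n},y_1,\dots,y_\ell$ is a leaf of $G$ whose unique neighbour (joint) is $x_{2n-1}$. -/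

import Mathlib

open MvPolynomial

noncomputable section

namespace ScarfPowers

/-! ### Minimal free resolutions over a polynomial ring -/

/-- The homogeneous maximal ideal of `k[V]`, generated by all the variables. -/
def irrelevantIdeal (V k : Type*) [Field k] : Ideal (MvPolynomial V k) :=
  Ideal.span (Set.range X)

/-- The sequence `⋯ → F 2 → F 1 → F 0 → 0` of modules over `S = k[V]`, with maps
`d i : F (i + 1) → F i`, is a minimal free resolution of `S / I`: all `F i` are free, the homology
vanishes in positive degrees, the homology in degree zero (the cokernel of `d 0`) is isomorphic
to `S / I`, and the image of each differential lies in `𝔪 F i`. -/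
structure IsMinimalFreeResolution {V k : Type*} [Field k] (F : ℕ → Type*)
    [∀ i, AddCommGroup (F i)] [∀ i, Module (MvPolynomial V k) (F i)]
    (d : ∀ i, F (i + 1) →ₗ[MvPolynomial V k] F i) (I : Ideal (MvPolynomial V k)) : Prop where
  free : ∀ i, Module.Free (MvPolynomial V k) (F i)
  exact : ∀ i, Function.Exact (d (i + 1)) (d i)
  zeroth_homology :
    Nonempty ((F 0 ⧸ LinearMap.range (d 0)) ≃ₗ[MvPolynomial V k] (MvPolynomial V k ⧸ I))
  minimal : ∀ i, LinearMap.range (d i) ≤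
    irrelevantIdeal V k • (⊤ : Submodule (MvPolynomial V k) (F i))

/-! ### The Taylor and Scarf complexes -/

/-- The minimal monomial generators of a monomial ideal, given by their exponent vectors:
the monomials of the ideal that are minimal with respect to divisibility. -/
def mingens {V k : Type*} [Field k] (I : Ideal (MvPolynomial V k)) : Set (V →₀ ℕ) :=
  {a | Minimal (fun b : V →₀ ℕ => monomial b (1 : k) ∈ I) a}

/-- The label of a finite set of monomials: the exponent vector of their least common multiple. -/
def label {V : Type*} (σ : Finset (V →₀ ℕ)) : V →₀ ℕ :=
  σ.sup id

/-- The full simplex on the minimal monomial generators of `I`. A simplicial complex (the empty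
face included) is a lower set of finite sets. -/
def taylorFaces {V k : Type*} [Field k] (I : Ideal (MvPolynomial V k)) :
    LowerSet (Finset (V →₀ ℕ)) where
  carrier := {σ | (σ : Set (V →₀ ℕ)) ⊆ mingens I}
  lower' := fun _ _ h hσ => (Finset.coe_subset.mpr h).trans hσ

/-- The Scarf simplicial complex of `I`: the faces of the full simplex on the minimal monomial
generators whose label is not the label of any other face. -/
def scarfFaces {V k : Type*} [Field k] (I : Ideal (MvPolynomial V k)) :
    LowerSet (Finset (V →₀ ℕ)) where
  carrier := {σ | σ ∈ taylorFaces I ∧ ∀ τ ∈ taylorFaces I, label τ = label σ → τ = σ}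
  lower' := by
    classical
    rintro σ τ hle ⟨hσ, hu⟩
    have hτσ : τ ⊆ σ := hle
    refine ⟨(taylorFaces I).lower hle hσ, fun ρ hρ hl => ?_⟩
    have h1 : ρ ∪ (σ \ τ) = σ := by
      refine hu _ ?_ ?_
      · intro m hm
        rcases Finset.mem_union.mp (Finset.mem_coe.mp hm) with h | h
        · exact hρ h
        · exact hσ (Finset.mem_sdiff.mp h).1
      · have h3 : label σ = label (τ ∪ (σ \ τ)) := by rw [Finset.union_sdiff_of_subset hτσ]
        rw [h3]
        simp only [label, Finset.sup_union] at hl ⊢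
        rw [hl]
    refine Finset.Subset.antisymm (fun m hm => ?_) (fun m hm => ?_)
    · by_contra hmτ
      have hmσ : m ∈ σ := h1 ▸ Finset.mem_union_left _ hm
      have h2 : σ.erase m = σ := by
        refine hu _ ((taylorFaces I).lower (Finset.erase_subset m σ) hσ) ?_
        refine le_antisymm (Finset.sup_mono (Finset.erase_subset m σ)) ?_
        have hτe : τ ⊆ σ.erase m := fun a ha =>
          Finset.mem_erase.mpr ⟨fun h => hmτ (h ▸ ha), hτσ ha⟩
        have hm' : m ≤ label (σ.erase m) :=
          calc m ≤ label ρ := Finset.le_sup (f := id) hm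
            _ = label τ := hl
            _ ≤ label (σ.erase m) := Finset.sup_mono hτe
        refine Finset.sup_le fun a ha => ?_
        by_cases h : a = m
        · exact h ▸ hm'
        · exact Finset.le_sup (f := id) (Finset.mem_erase.mpr ⟨h, ha⟩)
      exact Finset.erase_eq_self.mp h2 hmσ
    · have hmσ : m ∈ ρ ∪ (σ \ τ) := h1.symm.subset (hτσ hm)
      rcases Finset.mem_union.mp hmσ with h | h
      · exact h
      · exact absurd hm (Finset.mem_sdiff.mp h).2

/-- The free `S`-module, `S = k[V]`, with basis the faces of `Δ` that have `i` elements. -/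
abbrev Chains {V : Type*} (k : Type*) [Field k] (Δ : LowerSet (Finset (V →₀ ℕ))) (i : ℕ) : Type _ :=
  {σ : Finset (V →₀ ℕ) // σ ∈ Δ ∧ σ.card = i} →₀ MvPolynomial V k

open scoped Classical in
/-- The number of elements of `σ` that precede `m` in a fixed total order of the monomials. -/
def position {V : Type*} (σ : Finset (V →₀ ℕ)) (m : V →₀ ℕ) : ℕ :=
  (σ.filter fun a => WellOrderingRel a m).card

open scoped Classical in
/-- The facet of the face `σ` that is obtained by removing the vertex `m`. -/
def facet {V : Type*} {Δ : LowerSet (Finset (V →₀ ℕ))} {i : ℕ}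
    (σ : {σ : Finset (V →₀ ℕ) // σ ∈ Δ ∧ σ.card = i + 1}) (m : {m // m ∈ σ.1}) :
    {σ : Finset (V →₀ ℕ) // σ ∈ Δ ∧ σ.card = i} :=
  ⟨σ.1.erase m.1, Δ.lower (Finset.erase_subset m.1 σ.1) σ.2.1, by
    rw [Finset.card_erase_of_mem m.2, σ.2.2, Nat.add_sub_cancel]⟩

/-- The differential of the complex of `S`-modules induced by a simplicial complex `Δ` whose
vertices are monomials:
`e_σ ↦ ∑_{m ∈ σ} (-1)^(position of m in σ) * (lcm σ / lcm (σ \ {m})) * e_{σ \ {m}}`. -/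
def boundary {V : Type*} (k : Type*) [Field k] (Δ : LowerSet (Finset (V →₀ ℕ))) (i : ℕ) :
    Chains k Δ (i + 1) →ₗ[MvPolynomial V k] Chains k Δ i :=
  Finsupp.linearCombination (MvPolynomial V k) fun σ =>
    ∑ m : {m // m ∈ σ.1}, Finsupp.single (facet σ m)
      ((-1) ^ position σ.1 m.1 * monomial (label σ.1 - label (facet σ m).1) (1 : k))

/-- A monomial ideal `I` is Taylor if its Taylor complex is a minimal free resolution
of `S / I`. -/
def IsTaylor {V k : Type*} [Field k] (I : Ideal (MvPolynomial V k)) : Prop :=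
  IsMinimalFreeResolution (Chains k (taylorFaces I)) (boundary k (taylorFaces I)) I

/-- A monomial ideal `I` is Scarf if its Scarf complex is a minimal free resolution
of `S / I`. -/
def IsScarf {V k : Type*} [Field k] (I : Ideal (MvPolynomial V k)) : Prop :=
  IsMinimalFreeResolution (Chains k (scarfFaces I)) (boundary k (scarfFaces I)) I

/-! ### Edge ideals, squarefree powers, matchings -/

/-- The edge ideal of a graph. -/
def edgeIdeal {V : Type*} (k : Type*) [Field k] (G : SimpleGraph V) :
    Ideal (MvPolynomial V k) :=
  Ideal.span {p | ∃ v w, G.Adj v w ∧ p = X v * X w}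

/-- The `n`-th squarefree power of the edge ideal: the ideal generated by the squarefree monomials
that lie in the `n`-th power of the edge ideal. -/
def squarefreePower {V : Type*} (k : Type*) [Field k] (G : SimpleGraph V) (n : ℕ) :
    Ideal (MvPolynomial V k) :=
  Ideal.span {p | ∃ a : V →₀ ℕ, (∀ v, a v ≤ 1) ∧ monomial a (1 : k) ∈ edgeIdeal k G ^ n ∧
    p = monomial a (1 : k)}

/-- The matching number of a finite graph: the largest number of edges of a matching. -/
def matchingNumber {V : Type*} (G : SimpleGraph V) : ℕ :=
  sSup {m | ∃ M : G.Subgraph, M.IsMatching ∧ M.edgeSet.ncard = m}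

/-- The vertex `v` is a leaf of `G` and its joint, that is, its unique neighbour, is `w`. -/
def IsLeafWithJoint {V : Type*} (G : SimpleGraph V) (v w : V) : Prop :=
  G.neighborSet v = {w}

end ScarfPowers

end

/-! Both complexes are graded by exponent vectors: in multidegree `W` they are simplicial chain
complexes over `k` of the faces whose label divides `W`. For the Taylor complex this is a full
simplex, so it always resolves `S / I` (`boundary_taylorFaces_exact`), and it is minimal exactly
when no element of a face divides the lcm of the others (`range_boundary_le_iff`). In the minimal
case labels determine faces, so Taylor implies Scarf. In both cases of the graph condition, each
generator has a variable occurring in no other generator, which gives Taylor.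

For Scarf implies the graph condition, only exactness in homological degrees one and two is used:
the Scarf edges below `W` connect the generators below `W` (`exists_edge_of_exact`), and a 4-cycle
below `W` requires a triangle below `W` (`exists_triangle_of_exact`). The generators of the
squarefree power correspond to the `2n`-sets of vertices with a perfect matching. A Scarf face
contains every generator dividing its label, so once three generators lie below `W`, no Scarf edge
has lcm `W`.

Testing this on sets of `2n + 1` vertices shows that a vertex outside an `n`-matching has at most
one neighbour in it (`eq_of_adj_of_adj`). On `2n + 2` vertices it shows that a matching with `n + 1`
edges would span a connected graph, while the degree bound and `not_path` confine a component to two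
matching edges; since `n ≥ 2`, no such matching exists (`not_isPairing`). Hence the vertices outside
an `n`-matching are leaves attached to it. Exchanging one of them with the partner of its joint
shows that this partner is a leaf too, and two distinct joints would produce an unfilled square
(`joint_unique`). -/

noncomputable section

namespace ScarfPowers

open scoped Classical

variable {V : Type*} {k : Type*} [Field k]

/-! ### The differential in low degrees -/

/-- The faces of `Δ` with `i` elements. -/
abbrev Face (Δ : LowerSet (Finset (V →₀ ℕ))) (i : ℕ) : Type _ :=
  {σ : Finset (V →₀ ℕ) // σ ∈ Δ ∧ σ.card = i}

variable {Δ : LowerSet (Finset (V →₀ ℕ))}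

theorem boundary_single {i : ℕ} (σ : Face Δ (i + 1)) (p : MvPolynomial V k) :
    boundary k Δ i (Finsupp.single σ p) =
      ∑ m : {m // m ∈ σ.1}, Finsupp.single (facet σ m)
        (p * ((-1) ^ position σ.1 m.1 * monomial (label σ.1 - label (facet σ m).1) (1 : k))) := by
  rw [boundary, Finsupp.linearCombination_single, Finset.smul_sum]
  simp only [Finsupp.smul_single, smul_eq_mul]

theorem label_mono {σ τ : Finset (V →₀ ℕ)} (h : σ ⊆ τ) : label σ ≤ label τ :=
  Finset.sup_mono h

theorem le_label {σ : Finset (V →₀ ℕ)} {a : V →₀ ℕ} (h : a ∈ σ) : a ≤ label σ :=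
  Finset.le_sup (f := id) h

theorem label_le_iff {σ : Finset (V →₀ ℕ)} {W : V →₀ ℕ} : label σ ≤ W ↔ ∀ a ∈ σ, a ≤ W := by
  simp [label]

@[simp] theorem label_singleton (a : V →₀ ℕ) : label {a} = a := by simp [label]

@[simp] theorem label_empty : label (∅ : Finset (V →₀ ℕ)) = 0 := rfl

@[simp] theorem label_insert (a : V →₀ ℕ) (σ : Finset (V →₀ ℕ)) :
    label (insert a σ) = a ⊔ label σ := by simp [label]

/-- Passing from a face to a facet does not change the coefficient in multidegree `W`. -/
theorem coeff_mul_monomial_sub (p : MvPolynomial V k) {a b W : V →₀ ℕ} (hab : a ≤ b) :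
    (if a ≤ W then coeff (W - a) (p * monomial (b - a) (1 : k)) else 0) =
      if b ≤ W then coeff (W - b) p else 0 := by
  by_cases hb : b ≤ W
  · rw [if_pos (hab.trans hb), if_pos hb, coeff_mul_monomial',
      if_pos (tsub_le_tsub_right hb a), mul_one, tsub_tsub_tsub_cancel_right hab]
  · rw [if_neg hb]
    split_ifs with ha
    · rw [coeff_mul_monomial', if_neg]
      intro h
      exact hb (by simpa [tsub_add_cancel_of_le, hab, ha] using add_le_add_left h a)
    · rfl

/-- The boundary of an edge is, up to sign, the difference of its end points. -/
theorem boundary_pair {a b : V →₀ ℕ} (hab : a ≠ b) (h : ({a, b} : Finset (V →₀ ℕ)) ∈ Δ) :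
    ∃ s : k, (s = 1 ∨ s = -1) ∧ ∀ p : MvPolynomial V k,
      boundary k Δ 1 (Finsupp.single ⟨{a, b}, h, Finset.card_pair hab⟩ p) =
        s • (Finsupp.single ⟨{b}, Δ.lower (by simp) h, by simp⟩ (p * monomial (a ⊔ b - b) 1) -
          Finsupp.single ⟨{a}, Δ.lower (by simp) h, by simp⟩ (p * monomial (a ⊔ b - a) 1)) := by
  have key : ∀ p : MvPolynomial V k,
      boundary k Δ 1 (Finsupp.single ⟨{a, b}, h, Finset.card_pair hab⟩ p) =
        Finsupp.single ⟨{b}, Δ.lower (by simp) h, by simp⟩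
          (p * ((-1) ^ position {a, b} a * monomial (a ⊔ b - b) 1)) +
        Finsupp.single ⟨{a}, Δ.lower (by simp) h, by simp⟩
          (p * ((-1) ^ position {a, b} b * monomial (a ⊔ b - a) 1)) := by
    intro p
    rw [boundary_single]
    have hu : (Finset.univ : Finset {m // m ∈ ({a, b} : Finset (V →₀ ℕ))}) =
        {⟨a, by simp⟩, ⟨b, by simp⟩} := by
      ext ⟨m, hm⟩
      simp only [Finset.mem_univ, Finset.mem_insert, Finset.mem_singleton, Subtype.mk.injEq,
        true_iff]
      simpa using hm
    have ha : ({a, b} : Finset (V →₀ ℕ)).erase a = {b} := by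
      ext m; simp; grind
    have hb : ({a, b} : Finset (V →₀ ℕ)).erase b = {a} := by
      ext m; simp; grind
    rw [hu, Finset.sum_pair (by simpa using hab)]
    simp [facet, ha, hb]
  have hirr : ∀ m : V →₀ ℕ, ¬ WellOrderingRel m m := fun m => irrefl m
  rcases trichotomous_of (WellOrderingRel (α := V →₀ ℕ)) a b with hlt | heq | hlt
  · have hn : ¬ WellOrderingRel b a := fun h' => asymm hlt h'
    have pa : position {a, b} a = 0 := by
      simp [position, Finset.filter_insert, Finset.filter_singleton, hirr, hn]
    have pb : position {a, b} b = 1 := by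
      simp [position, Finset.filter_insert, Finset.filter_singleton, hirr, hlt]
    refine ⟨1, Or.inl rfl, fun p => ?_⟩
    rw [key, pa, pb]
    rw [pow_zero, pow_one, one_mul, one_smul, neg_mul, one_mul, mul_neg, Finsupp.single_neg,
      ← sub_eq_add_neg]
  · exact absurd heq hab
  · have hn : ¬ WellOrderingRel a b := fun h' => asymm hlt h'
    have pa : position {a, b} a = 1 := by
      simp [position, Finset.filter_insert, Finset.filter_singleton, hirr, hlt]
    have pb : position {a, b} b = 0 := by
      simp [position, Finset.filter_insert, Finset.filter_singleton, hirr, hn]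
    refine ⟨-1, Or.inr rfl, fun p => ?_⟩
    rw [key, pa, pb]
    rw [pow_zero, pow_one, one_mul, neg_mul, one_mul, mul_neg, Finsupp.single_neg, neg_smul,
      one_smul, neg_sub, neg_add_eq_sub]

theorem boundary_singleton {a : V →₀ ℕ} (h : ({a} : Finset (V →₀ ℕ)) ∈ Δ)
    (p : MvPolynomial V k) :
    boundary k Δ 0 (Finsupp.single ⟨{a}, h, by simp⟩ p) =
      Finsupp.single ⟨∅, Δ.lower (by simp) h, by simp⟩ (p * monomial a 1) := by
  have hp : position {a} a = 0 := by
    simp [position, Finset.filter_singleton, irrefl a]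
  rw [boundary_single]
  have hu : (Finset.univ : Finset {m // m ∈ ({a} : Finset (V →₀ ℕ))}) =
      {⟨a, by simp⟩} := by
    ext ⟨m, hm⟩
    simp only [Finset.mem_univ, Finset.mem_singleton, Subtype.mk.injEq, true_iff]
    simpa using hm
  rw [hu, Finset.sum_singleton]
  simp [facet, hp]

/-! ### Exactness in low degrees: connectivity and 4-cycles below a multidegree -/

/-- If the complex is exact in homological degree one, then the vertices below `W` are connected
by edges below `W`. -/
theorem exists_edge_of_exact (hex : Function.Exact (boundary k Δ 1) (boundary k Δ 0))
    {W a b : V →₀ ℕ} (ha : {a} ∈ Δ) (hb : {b} ∈ Δ) (haW : a ≤ W) (hbW : b ≤ W)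
    (P : (V →₀ ℕ) → Prop) (hPa : P a) (hPb : ¬ P b) :
    ∃ c d, ({c, d} : Finset (V →₀ ℕ)) ∈ Δ ∧ c ≤ W ∧ d ≤ W ∧ P c ∧ ¬ P d := by
  by_contra! hcon
  let A : Face Δ 1 := ⟨{a}, ha, by simp⟩
  let B : Face Δ 1 := ⟨{b}, hb, by simp⟩
  let z : Chains k Δ 1 := Finsupp.single A (monomial (W - a) 1) -
    Finsupp.single B (monomial (W - b) 1)
  have hz : boundary k Δ 0 z = 0 := by
    have hA := boundary_singleton (k := k) ha (monomial (W - a) 1)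
    have hB := boundary_singleton (k := k) hb (monomial (W - b) 1)
    rw [monomial_mul, tsub_add_cancel_of_le haW] at hA
    rw [monomial_mul, tsub_add_cancel_of_le hbW] at hB
    exact (map_sub _ _ _).trans (sub_eq_zero.mpr (hA.trans hB.symm))
  obtain ⟨y, hy⟩ := (hex z).mp hz
  -- `φ` is the indicator cochain of the vertices below `W` satisfying `P`. If no edge below `W`
  -- crosses from `P` to its complement, it kills every boundary, yet it takes the value 1 on `z`.
  let φ : Chains k Δ 1 →ₗ[k] k := Finsupp.lsum k fun σ =>
    if label σ.1 ≤ W ∧ P (label σ.1) then lcoeff k (W - label σ.1) else 0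
  have hφ : ∀ y, φ (boundary k Δ 1 y) = 0 := by
    intro y
    induction y using Finsupp.induction_linear with
    | zero => simp
    | add f g hf hg => rw [map_add, map_add, hf, hg, add_zero]
    | single σ p =>
      obtain ⟨σ, hσ, hc⟩ := σ
      obtain ⟨c, d, hcd, rfl⟩ := Finset.card_eq_two.mp hc
      obtain ⟨s, -, hs⟩ := boundary_pair (k := k) hcd hσ
      rw [hs p, map_smul, map_sub]
      have h1 := coeff_mul_monomial_sub p (W := W) (le_sup_left : c ≤ c ⊔ d)
      have h2 := coeff_mul_monomial_sub p (W := W) (le_sup_right : d ≤ c ⊔ d)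
      have h3 := hcon c d hσ
      have h4 := hcon d c (Finset.pair_comm c d ▸ hσ)
      have h5 : c ⊔ d ≤ W ↔ c ≤ W ∧ d ≤ W := sup_le_iff
      simp only [φ, Finsupp.lsum_single, label_singleton]
      split_ifs <;> simp <;> grind
  have h1 : φ z = 1 := by
    have lA : label A.1 = a := by simp [A]
    have lB : label B.1 = b := by simp [B]
    simp only [φ, z, map_sub, Finsupp.lsum_single, lA, lB, haW, hPa, hPb]
    simp
  rw [← hy, hφ] at h1
  exact zero_ne_one h1

/-- If the complex is exact in homological degree two and has a cycle of length four below `W`,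
then it has a triangle below `W`. -/
theorem exists_triangle_of_exact (hex : Function.Exact (boundary k Δ 2) (boundary k Δ 1))
    {W a b c d : V →₀ ℕ} (hab : {a, b} ∈ Δ) (hbc : {b, c} ∈ Δ) (hcd : {c, d} ∈ Δ)
    (hda : {d, a} ∈ Δ) (haW : a ≤ W) (hbW : b ≤ W) (hcW : c ≤ W) (hdW : d ≤ W)
    (nab : a ≠ b) (nbc : b ≠ c) (ncd : c ≠ d) (nda : d ≠ a) (nac : a ≠ c) (nbd : b ≠ d) :
    ∃ σ ∈ Δ, σ.card = 3 ∧ label σ ≤ W := by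
  by_contra! hcon
  obtain ⟨s₁, h₁, e₁⟩ := boundary_pair (k := k) nab hab
  obtain ⟨s₂, h₂, e₂⟩ := boundary_pair (k := k) nbc hbc
  obtain ⟨s₃, h₃, e₃⟩ := boundary_pair (k := k) ncd hcd
  obtain ⟨s₄, h₄, e₄⟩ := boundary_pair (k := k) nda hda
  let F₁ : Face Δ 2 := ⟨{a, b}, hab, Finset.card_pair nab⟩
  let F₂ : Face Δ 2 := ⟨{b, c}, hbc, Finset.card_pair nbc⟩
  let F₃ : Face Δ 2 := ⟨{c, d}, hcd, Finset.card_pair ncd⟩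
  let F₄ : Face Δ 2 := ⟨{d, a}, hda, Finset.card_pair nda⟩
  have edge : ∀ {s : k} {F : Face Δ 2} {x y : V →₀ ℕ} (X Y : Face Δ 1), (s = 1 ∨ s = -1) →
      x ≤ W → y ≤ W →
      (∀ p, boundary k Δ 1 (Finsupp.single F p) = s • (Finsupp.single Y
        (p * monomial (x ⊔ y - y) 1) - Finsupp.single X (p * monomial (x ⊔ y - x) 1))) →
      boundary k Δ 1 (s • Finsupp.single F (monomial (W - x ⊔ y) 1)) =
        Finsupp.single Y (monomial (W - y) 1) - Finsupp.single X (monomial (W - x) 1) := by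
    intro s F x y X Y hs hx hy h
    have hs2 : s * s = 1 := by rcases hs with rfl | rfl <;> simp
    have hxy : x ⊔ y ≤ W := sup_le hx hy
    rw [Finsupp.smul_single, smul_monomial, smul_eq_mul, mul_one, h]
    simp only [monomial_mul, mul_one, smul_sub, Finsupp.smul_single, smul_monomial, smul_eq_mul,
      hs2]
    rw [tsub_add_tsub_cancel hxy le_sup_left, tsub_add_tsub_cancel hxy le_sup_right]
  -- The signs `s₁, …, s₄` orient the four edges coherently around the square.
  let z : Chains k Δ 2 := s₁ • Finsupp.single F₁ (monomial (W - a ⊔ b) 1) +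
    s₂ • Finsupp.single F₂ (monomial (W - b ⊔ c) 1) +
    s₃ • Finsupp.single F₃ (monomial (W - c ⊔ d) 1) +
    s₄ • Finsupp.single F₄ (monomial (W - d ⊔ a) 1)
  have hz : boundary k Δ 1 z = 0 := by
    simp only [z, map_add]
    rw [edge _ _ h₁ haW hbW e₁, edge _ _ h₂ hbW hcW e₂, edge _ _ h₃ hcW hdW e₃,
      edge _ _ h₄ hdW haW e₄]
    abel
  obtain ⟨y, hy⟩ := (hex z).mp hz
  -- `φ` reads off the coefficient of the edge `{a, b}` in multidegree `W`: it is `s₁ = ±1` on the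
  -- cycle, and 0 on boundaries when no triangle lies below `W`.
  let φ : Chains k Δ 2 →ₗ[k] k := Finsupp.lsum k fun σ =>
    if label σ.1 ≤ W ∧ σ = F₁ then lcoeff k (W - label σ.1) else 0
  have hφ : ∀ y, φ (boundary k Δ 2 y) = 0 := by
    intro y
    induction y using Finsupp.induction_linear with
    | zero => simp
    | add f g hf hg => rw [map_add, map_add, hf, hg, add_zero]
    | single σ p =>
      rw [boundary_single, map_sum]
      refine Finset.sum_eq_zero fun m _ => ?_
      have h1 := coeff_mul_monomial_sub (p * (-1) ^ position σ.1 m.1) (W := W)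
        (label_mono (Finset.erase_subset m.1 σ.1))
      rw [if_neg (hcon σ.1 σ.2.1 σ.2.2)] at h1
      simp only [φ, Finsupp.lsum_single]
      rw [← mul_assoc]
      split_ifs with h
      · exact (if_pos h.1).symm.trans h1
      · rfl
  have h1 : φ z = s₁ := by
    have n2 : F₂ ≠ F₁ := fun h => by
      have : c ∈ F₁.1 := h ▸ (by simp [F₂])
      simp [F₁] at this; grind
    have n3 : F₃ ≠ F₁ := fun h => by
      have : c ∈ F₁.1 := h ▸ (by simp [F₃])
      simp [F₁] at this; grind
    have n4 : F₄ ≠ F₁ := fun h => by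
      have : d ∈ F₁.1 := h ▸ (by simp [F₄])
      simp [F₁] at this; grind
    have l1 : label F₁.1 = a ⊔ b := by simp [F₁]
    have l2 : a ⊔ b ≤ W := sup_le haW hbW
    simp only [z, map_add, map_smul, φ, Finsupp.lsum_single, n2, n3, n4, l1, l2]
    simp
  rw [← hy, hφ] at h1
  rcases h₁ with rfl | rfl <;> simp at h1

/-! ### Exactness of the Taylor complex -/

variable (k Δ) in
/-- The multiple of the basis element `e_σ` that has multidegree `W`; it is zero if `σ` is not a
face of `Δ` with `i` elements. -/
def gradedChain (i : ℕ) (W : V →₀ ℕ) (σ : Finset (V →₀ ℕ)) : Chains k Δ i :=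
  if h : σ ∈ Δ ∧ σ.card = i then Finsupp.single ⟨σ, h⟩ (monomial (W - label σ) 1) else 0

theorem gradedChain_face {i : ℕ} (W : V →₀ ℕ) (σ : Face Δ i) :
    gradedChain k Δ i W σ.1 = Finsupp.single σ (monomial (W - label σ.1) 1) :=
  dif_pos σ.2

theorem gradedChain_of_card_ne {i : ℕ} (W : V →₀ ℕ) {σ : Finset (V →₀ ℕ)} (h : σ.card ≠ i) :
    gradedChain k Δ i W σ = 0 :=
  dif_neg fun h' => h h'.2

theorem single_monomial {i : ℕ} (σ : Face Δ i) (s : V →₀ ℕ) (c : k) :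
    (Finsupp.single σ (monomial s c) : Chains k Δ i) =
      c • gradedChain k Δ i (s + label σ.1) σ.1 := by
  rw [gradedChain_face, Finsupp.smul_single, smul_monomial, smul_eq_mul, mul_one,
    add_tsub_cancel_right]

/-- Homogeneity: inside one multidegree the monomial coefficients are absorbed, leaving only the
signs of the simplicial boundary. -/
theorem boundary_gradedChain {i : ℕ} {W : V →₀ ℕ} {σ : Finset (V →₀ ℕ)} (hσ : σ ∈ Δ)
    (hc : σ.card = i + 1) (hW : label σ ≤ W) :
    boundary k Δ i (gradedChain k Δ (i + 1) W σ) =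
      ∑ m ∈ σ, (-1 : k) ^ position σ m • gradedChain k Δ i W (σ.erase m) := by
  rw [gradedChain_face W ⟨σ, hσ, hc⟩, boundary_single,
    ← Finset.sum_coe_sort σ fun m => (-1 : k) ^ position σ m • gradedChain k Δ i W (σ.erase m)]
  refine Finset.sum_congr rfl fun m _ => ?_
  have hm : label (σ.erase m.1) ≤ label σ := label_mono (Finset.erase_subset _ _)
  rw [show σ.erase m.1 = (facet ⟨σ, hσ, hc⟩ m : Face Δ i).1 from rfl, gradedChain_face,
    Finsupp.smul_single, mul_left_comm, monomial_mul, mul_one]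
  change Finsupp.single _ (_ * monomial (W - label σ + (label σ - label (σ.erase m.1))) 1) =
    Finsupp.single _ (_ • monomial (W - label (σ.erase m.1)) 1)
  rw [tsub_add_tsub_cancel hW hm, smul_eq_C_mul]
  simp only [map_pow, map_neg, map_one]

theorem position_erase_of_rel {σ : Finset (V →₀ ℕ)} {m m' : V →₀ ℕ} (hm : m ∈ σ)
    (h : WellOrderingRel m m') : position σ m' = position (σ.erase m) m' + 1 := by
  unfold position
  rw [Finset.filter_erase, Finset.card_erase_add_one]
  simp [hm, h]

theorem position_erase_of_not_rel {σ : Finset (V →₀ ℕ)} {m m' : V →₀ ℕ}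
    (h : ¬ WellOrderingRel m m') : position (σ.erase m) m' = position σ m' := by
  unfold position
  rw [Finset.filter_erase, Finset.erase_eq_of_notMem]
  simp [h]

/-- Removing the earlier of two vertices lowers the position of the later one by one, while removing
the later one does not affect the earlier. -/
theorem neg_one_pow_position {σ : Finset (V →₀ ℕ)} {m m' : V →₀ ℕ} (hm : m ∈ σ) (hm' : m' ∈ σ)
    (hne : m ≠ m') :
    (-1 : k) ^ position σ m * (-1) ^ position (σ.erase m) m' +
      (-1) ^ position σ m' * (-1) ^ position (σ.erase m') m = 0 := by
  rcases trichotomous_of (WellOrderingRel (α := V →₀ ℕ)) m m' with h | h | h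
  · rw [position_erase_of_rel hm h, position_erase_of_not_rel (asymm h)]
    ring
  · exact absurd h hne
  · rw [position_erase_of_rel hm' h, position_erase_of_not_rel (asymm h)]
    ring

theorem boundary_boundary (i : ℕ) (z : Chains k Δ (i + 1 + 1)) :
    boundary k Δ i (boundary k Δ (i + 1) z) = 0 := by
  induction z using Finsupp.induction_linear with
  | zero => simp
  | add f g hf hg => rw [map_add, map_add, hf, hg, add_zero]
  | single σ p =>
    have h1 : (Finsupp.single σ p : Chains k Δ (i + 1 + 1)) =
        p • gradedChain k Δ _ (label σ.1) σ.1 := by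
      rw [gradedChain_face, Finsupp.smul_single, tsub_self]
      simp
    rw [h1, map_smul, map_smul, boundary_gradedChain σ.2.1 σ.2.2 le_rfl, map_sum]
    have h2 : ∀ m ∈ σ.1, boundary k Δ i ((-1 : k) ^ position σ.1 m •
        gradedChain k Δ (i + 1) (label σ.1) (σ.1.erase m)) =
        ∑ m' ∈ σ.1.erase m, ((-1 : k) ^ position σ.1 m * (-1 : k) ^ position (σ.1.erase m) m') •
          gradedChain k Δ i (label σ.1) ((σ.1.erase m).erase m') := by
      intro m hm
      rw [LinearMap.map_smul_of_tower, boundary_gradedChain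
        (Δ.lower (Finset.erase_subset m σ.1) σ.2.1)
        (by rw [Finset.card_erase_of_mem hm, σ.2.2]; rfl)
        (label_mono (Finset.erase_subset _ _)), Finset.smul_sum]
      simp only [smul_smul]
    rw [Finset.sum_congr rfl h2, Finset.sum_sigma']
    -- Removing `m` then `m'` cancels against removing `m'` then `m`.
    rw [Finset.sum_involution (fun x _ => ⟨x.2, x.1⟩), smul_zero]
    · rintro ⟨m, m'⟩ hx
      simp only [Finset.mem_sigma, Finset.mem_erase] at hx
      rw [Finset.erase_right_comm (a := m'), ← add_smul,
        neg_one_pow_position hx.1 hx.2.2 (Ne.symm hx.2.1), zero_smul]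
    · rintro ⟨m, m'⟩ hx _ h
      simp only [Finset.mem_sigma, Finset.mem_erase] at hx
      exact hx.2.1 (Sigma.mk.inj_iff.mp h).1
    · rintro ⟨m, m'⟩ hx
      simp only [Finset.mem_sigma, Finset.mem_erase] at hx ⊢
      exact ⟨hx.2.2, Ne.symm hx.2.1, hx.1⟩
    · rintro ⟨m, m'⟩ hx
      rfl

variable (k Δ) in
/-- The cone operator that joins in multidegree `W` the vertex `g W` to each face. -/
def coneMap (g : (V →₀ ℕ) → (V →₀ ℕ)) (i : ℕ) : Chains k Δ i →ₗ[k] Chains k Δ (i + 1) :=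
  -- The map is only `k`-linear, because the vertex joined depends on the multidegree `s + label σ`.
  -- If that vertex already lies in `σ`, the cardinality is wrong and `gradedChain` is zero, as a
  -- cone requires.
  Finsupp.lsum k fun σ => (basisMonomials V k).constr k fun s =>
    gradedChain k Δ (i + 1) (s + label σ.1) (insert (g (s + label σ.1)) σ.1)

theorem coneMap_gradedChain (g : (V →₀ ℕ) → (V →₀ ℕ)) {i : ℕ} {W : V →₀ ℕ}
    {σ : Finset (V →₀ ℕ)} (hσ : σ ∈ Δ) (hc : σ.card = i) (hW : label σ ≤ W) :
    coneMap k Δ g i (gradedChain k Δ i W σ) = gradedChain k Δ (i + 1) W (insert (g W) σ) := by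
  rw [gradedChain_face W ⟨σ, hσ, hc⟩, coneMap, Finsupp.lsum_single]
  have := (basisMonomials V k).constr_basis k (fun s =>
    gradedChain k Δ (i + 1) (s + label σ) (insert (g (s + label σ)) σ)) (W - label σ)
  rw [coe_basisMonomials, tsub_add_cancel_of_le hW] at this
  exact this

/-- The cone operator is a contracting homotopy on the full simplex. -/
theorem boundary_coneMap_add {M : Set (V →₀ ℕ)} (hΔ : ∀ σ, σ ∈ Δ ↔ (σ : Set (V →₀ ℕ)) ⊆ M)
    {g : (V →₀ ℕ) → (V →₀ ℕ)} (hg : ∀ W, ∀ a ∈ M, a ≤ W →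
      g W ∈ M ∧ g W ≤ W ∧ ∀ b ∈ M, b ≤ W → ¬ WellOrderingRel b (g W))
    (i : ℕ) (z : Chains k Δ (i + 1)) :
    boundary k Δ (i + 1) (coneMap k Δ g (i + 1) z) + coneMap k Δ g i (boundary k Δ i z) = z := by
  induction z using Finsupp.induction_linear with
  | zero => simp
  | add x y hx hy =>
    simp only [map_add]
    rw [add_add_add_comm, hx, hy]
  | single σ p =>
    induction p using MvPolynomial.induction_on' with
    | add p q hp hq =>
      rw [Finsupp.single_add]
      simp only [map_add]
      rw [add_add_add_comm, hp, hq]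
    | monomial s c =>
      rw [single_monomial, map_smul, LinearMap.map_smul_of_tower, LinearMap.map_smul_of_tower,
        map_smul, ← smul_add]
      congr 1
      obtain ⟨σ, hσ, hc⟩ := σ
      have hW : label σ ≤ s + label σ := le_add_self
      revert hW
      generalize s + label σ = W
      intro hW
      have hσM := (hΔ σ).mp hσ
      obtain ⟨a, ha⟩ : σ.Nonempty := Finset.card_pos.mp (by omega)
      obtain ⟨hgM, hgW, hmin⟩ := hg W a (hσM ha) ((le_label ha).trans hW)
      have hmin' : ∀ b ∈ σ, ¬ WellOrderingRel b (g W) := fun b hb =>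
        hmin b (hσM hb) ((le_label hb).trans hW)
      -- The apex precedes all other vertices, so it is removed with sign `+1`.
      have hpos : ∀ τ : Finset (V →₀ ℕ), (∀ b ∈ τ, b = g W ∨ b ∈ σ) → position τ (g W) = 0 := by
        intro τ hτ
        rw [position, Finset.card_eq_zero, Finset.filter_eq_empty_iff]
        intro b hb
        rcases hτ b hb with rfl | h
        · exact irrefl _
        · exact hmin' b h
      rw [coneMap_gradedChain g hσ hc hW, boundary_gradedChain hσ hc hW, map_sum]
      have h2 : ∀ m ∈ σ, coneMap k Δ g i ((-1 : k) ^ position σ m •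
          gradedChain k Δ i W (σ.erase m)) = (-1 : k) ^ position σ m •
            gradedChain k Δ (i + 1) W (insert (g W) (σ.erase m)) := by
        intro m hm
        rw [map_smul, coneMap_gradedChain g (Δ.lower (Finset.erase_subset m σ) hσ)
          (by rw [Finset.card_erase_of_mem hm, hc]; rfl)
          ((label_mono (Finset.erase_subset _ _)).trans hW)]
      rw [Finset.sum_congr rfl h2]
      by_cases hgσ : g W ∈ σ
      · rw [Finset.insert_eq_of_mem hgσ, gradedChain_of_card_ne _ (by omega), map_zero, zero_add,
          Finset.sum_eq_single_of_mem _ hgσ, Finset.insert_erase hgσ,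
          hpos σ fun b hb => Or.inr hb, pow_zero, one_smul]
        intro m hm hne
        rw [Finset.insert_eq_of_mem (Finset.mem_erase.mpr ⟨hne.symm, hgσ⟩),
          gradedChain_of_card_ne, smul_zero]
        rw [Finset.card_erase_of_mem hm]
        omega
      · have hins : insert (g W) σ ∈ Δ := by
          rw [hΔ, Finset.coe_insert]
          exact Set.insert_subset hgM hσM
        rw [boundary_gradedChain hins (by rw [Finset.card_insert_of_notMem hgσ, hc])
          (by rw [label_insert]; exact sup_le hgW hW), Finset.sum_insert hgσ,
          Finset.erase_insert hgσ, hpos _ fun b hb => Finset.mem_insert.mp hb, pow_zero, one_smul,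
          add_assoc, ← Finset.sum_add_distrib]
        rw [Finset.sum_eq_zero, add_zero]
        intro m hm
        have hne : m ≠ g W := fun h => hgσ (h ▸ hm)
        have hlt : WellOrderingRel (g W) m := by
          rcases trichotomous_of (WellOrderingRel (α := V →₀ ℕ)) m (g W) with h | h | h
          · exact absurd h (hmin' m hm)
          · exact absurd h hne
          · exact h
        rw [position_erase_of_rel (Finset.mem_insert_self (g W) σ) hlt, Finset.erase_insert hgσ,
          Finset.erase_insert_of_ne hne.symm, pow_succ, mul_neg_one, neg_smul, neg_add_cancel]

/-- In multidegree `W` the complex belongs to the full simplex on the generators below `W`; this is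
a cone over the least of them in the fixed well-order, and coning is a contracting homotopy. -/
theorem boundary_taylorFaces_exact (I : Ideal (MvPolynomial V k)) (i : ℕ) :
    Function.Exact (boundary k (taylorFaces I) (i + 1)) (boundary k (taylorFaces I) i) := by
  have hwf : WellFounded (WellOrderingRel (α := V →₀ ℕ)) := WellOrderingRel.isWellOrder.wf
  have hex : ∀ W : V →₀ ℕ, ∃ g, ∀ a ∈ mingens I, a ≤ W →
      g ∈ mingens I ∧ g ≤ W ∧ ∀ b ∈ mingens I, b ≤ W → ¬ WellOrderingRel b g := by
    intro W
    by_cases h : {a | a ∈ mingens I ∧ a ≤ W}.Nonempty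
    · exact ⟨hwf.min _ h, fun _ _ _ => ⟨(hwf.min_mem _ h).1, (hwf.min_mem _ h).2,
        fun b hb hbW => hwf.not_lt_min (s := {a | a ∈ mingens I ∧ a ≤ W}) ⟨hb, hbW⟩⟩⟩
    · exact ⟨0, fun a ha haW => absurd ⟨a, ha, haW⟩ h⟩
  choose g hg using hex
  intro z
  constructor
  · intro hz
    have h := boundary_coneMap_add (k := k) (Δ := taylorFaces I) (fun _ => Iff.rfl) hg i z
    rw [hz, map_zero, add_zero] at h
    exact ⟨_, h⟩
  · rintro ⟨y, rfl⟩
    exact boundary_boundary i y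

/-! ### Homology in degree zero and minimality -/

theorem monomial_mem_of_mem_mingens {I : Ideal (MvPolynomial V k)} {a : V →₀ ℕ}
    (ha : a ∈ mingens I) : monomial a (1 : k) ∈ I :=
  Minimal.prop (P := fun b : V →₀ ℕ => monomial b (1 : k) ∈ I) ha

/-- An ideal generated by monomials is generated by its minimal monomials. -/
theorem span_mingens {I : Ideal (MvPolynomial V k)} {A : Set (V →₀ ℕ)}
    (hI : I = Ideal.span ((fun a => monomial a (1 : k)) '' A)) :
    Ideal.span ((fun a => monomial a (1 : k)) '' mingens I) = I := by
  apply le_antisymm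
  · rw [Ideal.span_le]
    rintro _ ⟨a, ha, rfl⟩
    exact monomial_mem_of_mem_mingens ha
  · conv_lhs => rw [hI]
    rw [Ideal.span_le]
    rintro _ ⟨a, ha, rfl⟩
    have haI : monomial a (1 : k) ∈ I := hI ▸ Ideal.subset_span ⟨a, ha, rfl⟩
    obtain ⟨b, hba, hb⟩ := exists_minimal_le_of_wellFoundedLT
      (fun b : V →₀ ℕ => monomial b (1 : k) ∈ I) a haI
    have : monomial a (1 : k) = monomial (a - b) 1 * monomial b 1 := by
      rw [monomial_mul, tsub_add_cancel_of_le hba, one_mul]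
    rw [SetLike.mem_coe]
    simp only [this]
    exact Ideal.mul_mem_left _ _ (Ideal.subset_span ⟨b, hb, rfl⟩)

/-- The empty face alone spans degree zero, so that module is `S`, and the singletons map to the
minimal generators. -/
theorem zeroth_homology_taylorFaces {I : Ideal (MvPolynomial V k)}
    (hI : Ideal.span ((fun a => monomial a (1 : k)) '' mingens I) = I) :
    Nonempty ((Chains k (taylorFaces I) 0 ⧸ LinearMap.range (boundary k (taylorFaces I) 0))
      ≃ₗ[MvPolynomial V k] (MvPolynomial V k ⧸ I)) := by
  have h0 : (∅ : Finset (V →₀ ℕ)) ∈ taylorFaces I := by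
    change ((∅ : Finset (V →₀ ℕ)) : Set (V →₀ ℕ)) ⊆ mingens I
    simp
  have : Subsingleton (Face (taylorFaces I) 0) :=
    ⟨fun σ τ => Subtype.ext
      ((Finset.card_eq_zero.mp σ.2.2).trans (Finset.card_eq_zero.mp τ.2.2).symm)⟩
  let f : Chains k (taylorFaces I) 0 ≃ₗ[MvPolynomial V k] MvPolynomial V k :=
    Finsupp.uniqueLinearEquiv _ _ ⟨∅, h0, rfl⟩
  have hf : ∀ (h : ∅ ∈ taylorFaces I ∧ (∅ : Finset (V →₀ ℕ)).card = 0) (p : MvPolynomial V k),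
      f (Finsupp.single ⟨∅, h⟩ p) = p := fun h p => Finsupp.single_eq_same
  refine ⟨Submodule.Quotient.equiv _ _ f ?_⟩
  apply le_antisymm
  · rintro _ ⟨_, ⟨z, rfl⟩, rfl⟩
    induction z using Finsupp.induction_linear with
    | zero => simp
    | add x y hx hy =>
      rw [map_add, map_add]
      exact I.add_mem hx hy
    | single σ p =>
      obtain ⟨σ, hσ, hc⟩ := σ
      obtain ⟨a, rfl⟩ := Finset.card_eq_one.mp hc
      have ha : monomial a (1 : k) ∈ I := 
        monomial_mem_of_mem_mingens (hσ (Finset.mem_singleton_self a))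
      have := boundary_singleton hσ p
      change f (boundary k (taylorFaces I) 0 _) ∈ I
      rw [this, hf]
      exact I.mul_mem_left _ ha
  · conv_lhs => rw [← hI]
    change Submodule.span _ _ ≤ _
    rw [Submodule.span_le]
    rintro _ ⟨a, ha, rfl⟩
    have hσ : {a} ∈ taylorFaces I := by
      change (({a} : Finset (V →₀ ℕ)) : Set (V →₀ ℕ)) ⊆ mingens I
      simpa using ha
    refine ⟨_, ⟨Finsupp.single ⟨{a}, hσ, by simp⟩ 1, rfl⟩, ?_⟩
    change f (boundary k (taylorFaces I) 0 _) = _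
    rw [boundary_singleton hσ 1, hf, one_mul]

theorem monomial_mem_irrelevantIdeal {s : V →₀ ℕ} (hs : s ≠ 0) :
    monomial s (1 : k) ∈ irrelevantIdeal V k := by
  obtain ⟨v, hv⟩ := Finsupp.ne_iff.mp hs
  have h : Finsupp.single v 1 ≤ s := by
    rw [Finsupp.single_le_iff]
    exact Nat.one_le_iff_ne_zero.mpr hv
  have : monomial s (1 : k) = monomial (s - Finsupp.single v 1) 1 * X v := by
    rw [X, monomial_mul, tsub_add_cancel_of_le h, one_mul]
  rw [this]
  exact Ideal.mul_mem_left _ _ (Ideal.subset_span ⟨v, rfl⟩)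

theorem constantCoeff_eq_zero_of_mem {p : MvPolynomial V k} (hp : p ∈ irrelevantIdeal V k) :
    constantCoeff p = 0 := by
  have : irrelevantIdeal V k ≤ RingHom.ker (constantCoeff : MvPolynomial V k →+* k) := by
    rw [irrelevantIdeal, Ideal.span_le]
    rintro _ ⟨v, rfl⟩
    simp [RingHom.mem_ker]
  exact this hp

/-- A complex of faces is minimal if and only if removing a vertex changes the label. -/
theorem range_boundary_le_iff (i : ℕ) :
    LinearMap.range (boundary k Δ i) ≤
        irrelevantIdeal V k • (⊤ : Submodule (MvPolynomial V k) (Chains k Δ i)) ↔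
      ∀ σ ∈ Δ, σ.card = i + 1 → ∀ m ∈ σ, label (σ.erase m) ≠ label σ := by
  constructor
  · intro h σ hσ hc m hm heq
    have h1 := h ⟨Finsupp.single ⟨σ, hσ, hc⟩ 1, rfl⟩
    have h2 : ∀ y ∈ irrelevantIdeal V k • (⊤ : Submodule (MvPolynomial V k) (Chains k Δ i)),
        ∀ τ, constantCoeff (y τ) = 0 := by
      intro y hy τ
      induction hy using Submodule.smul_induction_on' with
      | smul r hr n hn =>
        simp [constantCoeff_eq_zero_of_mem hr]
      | add x _ y _ hx hy => rw [Finsupp.add_apply, map_add, hx, hy, add_zero]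
    have h3 := h2 _ h1 (facet ⟨σ, hσ, hc⟩ ⟨m, hm⟩)
    -- Different vertices give different facets, so the coordinate opposite `m` is a single term; if
    -- the labels agreed it would be the unit `±1`.
    rw [boundary_single, Finsupp.finsetSum_apply,
      Finset.sum_eq_single (⟨m, hm⟩ : {m // m ∈ σ}), Finsupp.single_eq_same] at h3
    · have h4 : label σ - label (facet ⟨σ, hσ, hc⟩ ⟨m, hm⟩ : Face Δ i).1 = 0 := by
        change label σ - label (σ.erase m) = 0
        rw [heq, tsub_self]
      rw [h4] at h3
      simp at h3
    · intro m' _ hne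
      apply Finsupp.single_eq_of_ne'
      intro h
      apply hne
      have h' : σ.erase m'.1 = σ.erase m := congrArg Subtype.val h
      by_contra hne'
      have : m ∈ σ.erase m'.1 :=
        Finset.mem_erase.mpr ⟨fun h => hne' (Subtype.ext h.symm), hm⟩
      rw [h'] at this
      exact Finset.notMem_erase m σ this
    · simp
  · rintro h _ ⟨z, rfl⟩
    induction z using Finsupp.induction_linear with
    | zero => simp
    | add x y hx hy =>
      rw [map_add]
      exact Submodule.add_mem _ hx hy
    | single σ p =>
      rw [boundary_single]
      refine Submodule.sum_mem _ fun m _ => ?_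
      rw [← mul_one (p * _), ← smul_eq_mul (p * _), ← Finsupp.smul_single]
      refine Submodule.smul_mem_smul ?_ trivial
      refine Ideal.mul_mem_left _ _ (Ideal.mul_mem_left _ _ (monomial_mem_irrelevantIdeal ?_))
      intro h0
      refine h σ.1 σ.2.1 σ.2.2 m.1 m.2 (le_antisymm (label_mono (Finset.erase_subset _ _)) ?_)
      exact tsub_eq_zero_iff_le.mp h0

/-- By minimality, adjoining a new generator to a face must enlarge its label. A face therefore
contains every generator dividing its label and is determined by it, so the two complexes coincide.
-/
theorem IsTaylor.isScarf {I : Ideal (MvPolynomial V k)} (h : IsTaylor I) : IsScarf I := by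
  have hl : ∀ σ ∈ taylorFaces I, ∀ m ∈ σ, label (σ.erase m) ≠ label σ := by
    intro σ hσ m hm
    have hpos : 0 < σ.card := Finset.card_pos.mpr ⟨m, hm⟩
    exact (range_boundary_le_iff (σ.card - 1)).mp (h.minimal _) σ hσ (by omega) m hm
  have hsub : ∀ σ ∈ taylorFaces I, ∀ τ ∈ taylorFaces I, label τ ≤ label σ → τ ⊆ σ := by
    intro σ hσ τ hτ hle m hm
    by_contra hmσ
    have hins : insert m σ ∈ taylorFaces I := by
      change ((insert m σ : Finset (V →₀ ℕ)) : Set (V →₀ ℕ)) ⊆ mingens I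
      rw [Finset.coe_insert]
      exact Set.insert_subset (hτ hm) hσ
    apply hl _ hins m (Finset.mem_insert_self _ _)
    rw [Finset.erase_insert hmσ, label_insert, sup_eq_right.mpr ((le_label hm).trans hle)]
  have heq : scarfFaces I = taylorFaces I := by
    ext σ
    refine ⟨fun hσ => hσ.1, fun hσ => ⟨hσ, fun τ hτ hle => ?_⟩⟩
    exact Finset.Subset.antisymm (hsub σ hσ τ hτ hle.le) (hsub τ hτ σ hσ hle.ge)
  rw [IsScarf, heq]
  exact h

/-- A monomial ideal is Taylor if each minimal generator has a variable whose exponent is larger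
than in all other minimal generators. -/
theorem isTaylor_of_forall_exists_lt {I : Ideal (MvPolynomial V k)} {A : Set (V →₀ ℕ)}
    (hI : I = Ideal.span ((fun a => monomial a (1 : k)) '' A))
    (h : ∀ a ∈ mingens I, ∃ v, 0 < a v ∧ ∀ b ∈ mingens I, b ≠ a → b v < a v) : IsTaylor I where
  free _ := inferInstance
  exact := boundary_taylorFaces_exact I
  zeroth_homology := zeroth_homology_taylorFaces (span_mingens hI)
  minimal i := by
    rw [range_boundary_le_iff]
    intro σ hσ _ m hm heq
    obtain ⟨v, hv, hlt⟩ := h m (hσ hm)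
    have h1 : m v ≤ label (σ.erase m) v := heq ▸ le_label hm v
    -- The other generators have exponent at most `m v - 1` at `v`, so capping that coordinate still
    -- bounds their lcm. Positivity of `m v` makes the truncated subtraction harmless, also when
    -- nothing else is left in the face.
    have h2 : label (σ.erase m) ≤ label σ ⊓ (label (σ.erase m)).update v (m v - 1) := by
      rw [label_le_iff]
      intro b hb
      have hb' := Finset.mem_erase.mp hb
      refine le_inf (le_label hb'.2) fun w => ?_
      have h3 := hlt b (hσ hb'.2) hb'.1
      have h4 := le_label hb w
      rw [Finsupp.coe_update, Function.update_apply]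
      split_ifs with hw
      · subst hw; omega
      · exact h4
    have h3 := (h2.trans inf_le_right) v
    rw [Finsupp.coe_update, Function.update_self] at h3
    omega

variable {G : SimpleGraph V}

/-! ### Vertex sets with a perfect matching -/

variable (G) in
/-- The involution `f` is a perfect matching of the subgraph of `G` induced on `U`. -/
def IsPairing (f : V → V) (U : Finset V) : Prop :=
  ∀ u ∈ U, f u ∈ U ∧ G.Adj u (f u) ∧ f (f u) = u

variable (G) in
/-- The sets of `2 * n` vertices whose induced subgraph has a perfect matching. -/
def matchedSets (n : ℕ) : Set (Finset V) :=
  {U | U.card = 2 * n ∧ ∃ f, IsPairing G f U}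

namespace IsPairing

variable {f : V → V} {U : Finset V}

theorem ne (h : IsPairing G f U) {u : V} (hu : u ∈ U) : f u ≠ u :=
  (h u hu).2.1.ne'

theorem erase_pair (h : IsPairing G f U) {u : V} (hu : u ∈ U) :
    IsPairing G f ((U.erase u).erase (f u)) := by
  intro v hv
  simp only [Finset.mem_erase] at hv ⊢
  have h1 := h v hv.2.2
  have h2 := h u hu
  refine ⟨⟨fun h3 => hv.2.1 ?_, fun h3 => hv.1 ?_, h1.1⟩, h1.2⟩
  · rw [← h1.2.2, h3, h2.2.2]
  · rw [← h3, h1.2.2]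

theorem card_erase_pair (h : IsPairing G f U) {u : V} (hu : u ∈ U) :
    ((U.erase u).erase (f u)).card + 2 = U.card := by
  have h1 : f u ∈ U.erase u := Finset.mem_erase.mpr ⟨h.ne hu, (h u hu).1⟩
  have h2 := Finset.card_erase_add_one h1
  have h3 := Finset.card_erase_add_one hu
  omega

theorem even_card (h : IsPairing G f U) : Even U.card := by
  induction hm : U.card using Nat.strong_induction_on generalizing U with
  | _ m ih =>
    rcases U.eq_empty_or_nonempty with rfl | ⟨u, hu⟩
    · simp [← hm]
    · have h1 := h.card_erase_pair hu
      obtain ⟨r, hr⟩ := ih _ (by omega) (h.erase_pair hu) rfl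
      exact ⟨r + 1, by omega⟩

/-- Replace the partner of `p` by a new neighbour `v` of `p`. -/
theorem swap (h : IsPairing G f U) {v p : V} (hv : v ∉ U) (hp : p ∈ U) (hvp : G.Adj v p) :
    IsPairing G (Function.update (Function.update f v p) p v) ((insert v U).erase (f p)) := by
  intro u hu
  have hpv : p ≠ v := fun h => hv (h ▸ hp)
  have h0 := h p hp
  have h1 := h.ne hp
  simp only [Finset.mem_erase, Finset.mem_insert, Function.update_apply] at hu ⊢
  obtain ⟨hu1, rfl | hu2⟩ := hu
  · simp [hpv.symm, h1.symm, hp, hvp]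
  · have h2 := h u hu2
    by_cases hup : u = p
    · subst hup
      have : v ≠ f u := fun h => hv (h ▸ h0.1)
      simp [this, hpv.symm, hvp.symm]
    · have huv : u ≠ v := fun h => hv (h ▸ hu2)
      have h3 : f u ≠ p := fun h3 => hu1 (by rw [← h3, h2.2.2])
      have h4 : f u ≠ v := fun h3 => hv (h3 ▸ h2.1)
      have h5 : f u ≠ f p := fun h5 => hup (by rw [← h2.2.2, h5, h0.2.2])
      simp [hup, huv, h3, h4, h5, h2]

theorem card_swap (h : IsPairing G f U) {v p : V} (hv : v ∉ U) (hp : p ∈ U) :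
    ((insert v U).erase (f p)).card = U.card := by
  rw [Finset.card_erase_of_mem (Finset.mem_insert_of_mem (h p hp).1),
    Finset.card_insert_of_notMem hv, Nat.add_sub_cancel]

theorem insert_pair (h : IsPairing G f U) {v w : V} (hv : v ∉ U) (hw : w ∉ U) (hvw : G.Adj v w) :
    IsPairing G (Function.update (Function.update f v w) w v) (insert v (insert w U)) := by
  intro u hu
  have hne := hvw.ne
  simp only [Finset.mem_insert, Function.update_apply] at hu ⊢
  rcases hu with rfl | rfl | hu
  · simp [hne, hvw]
  · simp [hne, hvw.symm]
  · have h2 := h u hu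
    have h3 : u ≠ v := fun h => hv (h ▸ hu)
    have h4 : u ≠ w := fun h => hw (h ▸ hu)
    have h5 : f u ≠ v := fun h => hv (h ▸ h2.1)
    have h6 : f u ≠ w := fun h => hw (h ▸ h2.1)
    simp [h3, h4, h5, h6, h2]

theorem exists_subset (h : IsPairing G f U) {m n : ℕ} (hU : U.card = 2 * m) (hnm : n ≤ m) :
    ∃ U', IsPairing G f U' ∧ U'.card = 2 * n := by
  induction m generalizing U with
  | zero => exact ⟨U, h, by omega⟩
  | succ m ih =>
    by_cases hn : n = m + 1
    · exact ⟨U, h, by rw [hU, hn]⟩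
    · obtain ⟨u, hu⟩ : U.Nonempty := Finset.card_pos.mp (by omega)
      have := h.card_erase_pair hu
      exact ih (h.erase_pair hu) (by omega) (by omega)

/-- This puts a chosen edge last, joint before leaf, as the labelling of the vertices demands. -/
theorem exists_enumeration_extend (h : IsPairing G f U) {m : ℕ} {w : V} (hw : w ∈ U)
    (hx : ∃ x : ℕ → V, Set.InjOn x (Set.Iio (2 * m)) ∧
      x '' Set.Iio (2 * m) = ((U.erase w).erase (f w) : Finset V) ∧
      ∀ i < m, G.Adj (x (2 * i)) (x (2 * i + 1))) :
    ∃ x : ℕ → V, Set.InjOn x (Set.Iio (2 * (m + 1))) ∧ x '' Set.Iio (2 * (m + 1)) = U ∧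
      (∀ i < m + 1, G.Adj (x (2 * i)) (x (2 * i + 1))) ∧ x (2 * m) = w ∧ x (2 * m + 1) = f w := by
  obtain ⟨x, hinj, him, hadj⟩ := hx
  let x' : ℕ → V := fun j => if j < 2 * m then x j else if j = 2 * m then w else f w
  have hlt : ∀ j < 2 * m, x' j = x j := fun j hj => if_pos hj
  have h0 : x' (2 * m) = w := by simp [x']
  have h1 : x' (2 * m + 1) = f w := by simp [x']
  have hmem : ∀ j < 2 * m, x j ≠ f w ∧ x j ≠ w ∧ x j ∈ U := by
    intro j hj
    have : x j ∈ ((U.erase w).erase (f w) : Finset V) := by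
      rw [← Finset.mem_coe, ← him]
      exact ⟨j, hj, rfl⟩
    simpa only [Finset.mem_erase] using this
  have hcases : ∀ j < 2 * (m + 1), j < 2 * m ∨ j = 2 * m ∨ j = 2 * m + 1 := by omega
  have hne := h.ne hw
  refine ⟨x', ?_, ?_, ?_, h0, h1⟩
  · intro i hi j hj hij
    rcases hcases i hi with hi' | rfl | rfl <;> rcases hcases j hj with hj' | rfl | rfl
    · rw [hlt i hi', hlt j hj'] at hij
      exact hinj hi' hj' hij
    · rw [hlt i hi', h0] at hij
      exact absurd hij (hmem i hi').2.1
    · rw [hlt i hi', h1] at hij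
      exact absurd hij (hmem i hi').1
    · rw [hlt j hj', h0] at hij
      exact absurd hij.symm (hmem j hj').2.1
    · rfl
    · rw [h0, h1] at hij
      exact absurd hij.symm hne
    · rw [hlt j hj', h1] at hij
      exact absurd hij.symm (hmem j hj').1
    · rw [h0, h1] at hij
      exact absurd hij hne
    · rfl
  · ext u
    constructor
    · rintro ⟨j, hj, rfl⟩
      rcases hcases j hj with hj' | rfl | rfl
      · rw [hlt j hj']
        exact (hmem j hj').2.2
      · rw [h0]
        exact hw
      · rw [h1]
        exact (h w hw).1
    · intro hu
      by_cases hu1 : u = w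
      · exact ⟨2 * m, by simp, by rw [h0, hu1]⟩
      by_cases hu2 : u = f w
      · exact ⟨2 * m + 1, by simp; omega, by rw [h1, hu2]⟩
      have : u ∈ x '' Set.Iio (2 * m) := by
        rw [him]
        simpa [hu1, hu2] using hu
      obtain ⟨j, hj, rfl⟩ := this
      have hj' : j < 2 * m := hj
      exact ⟨j, by simp; omega, hlt j hj'⟩
  · intro i hi
    by_cases him : i = m
    · subst him
      rw [h0, h1]
      exact (h w hw).2.1
    · rw [hlt _ (by omega), hlt _ (by omega)]
      exact hadj i (by omega)

theorem exists_enumeration [Nonempty V] (h : IsPairing G f U) {m : ℕ} (hU : U.card = 2 * m) :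
    ∃ x : ℕ → V, Set.InjOn x (Set.Iio (2 * m)) ∧ x '' Set.Iio (2 * m) = U ∧
      ∀ i < m, G.Adj (x (2 * i)) (x (2 * i + 1)) := by
  induction m generalizing U with
  | zero =>
    have : U = ∅ := Finset.card_eq_zero.mp (by omega)
    exact ⟨fun _ => Classical.arbitrary V, by simp, by simp [this], by simp⟩
  | succ m ih =>
    obtain ⟨w, hw⟩ : U.Nonempty := Finset.card_pos.mp (by omega)
    have := h.card_erase_pair hw
    obtain ⟨x, h1, h2, h3, -⟩ :=
      h.exists_enumeration_extend hw (ih (h.erase_pair hw) (by omega))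
    exact ⟨x, h1, h2, h3⟩

end IsPairing

/-! ### Matchings as subgraphs -/

/-- Handshake lemma: the spanning subgraph has degree one on the matched vertices and zero
elsewhere. -/
theorem card_verts_of_isMatching [Fintype V] {M : G.Subgraph} (hM : M.IsMatching) :
    M.verts.ncard = 2 * M.edgeSet.ncard := by
  rw [Set.ncard_eq_toFinset_card']
  have h := M.spanningCoe.sum_degrees_eq_twice_card_edges
  have h1 : M.spanningCoe.edgeFinset.card = M.edgeSet.ncard := by
    rw [← M.edgeSet_spanningCoe, ← Set.ncard_coe_finset, SimpleGraph.coe_edgeFinset]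
  have h2 : ∀ v, M.spanningCoe.degree v = if v ∈ M.verts then 1 else 0 := by
    intro v
    split_ifs with hv
    · obtain ⟨w, hw, huniq⟩ := hM hv
      rw [← SimpleGraph.card_neighborFinset_eq_degree, Finset.card_eq_one]
      refine ⟨w, ?_⟩
      ext u
      simp only [SimpleGraph.mem_neighborFinset, SimpleGraph.Subgraph.spanningCoe_adj,
        Finset.mem_singleton]
      exact ⟨fun h => huniq u h, fun h => h ▸ hw⟩
    · rw [← SimpleGraph.card_neighborFinset_eq_degree, Finset.card_eq_zero]
      ext u
      simp only [SimpleGraph.mem_neighborFinset, SimpleGraph.Subgraph.spanningCoe_adj,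
        Finset.notMem_empty, iff_false]
      exact fun h => hv (M.edge_vert h)
  rw [h1] at h
  rw [← h, Finset.sum_congr rfl fun v _ => h2 v, Finset.sum_boole]
  simp only [Nat.cast_id]
  congr 1
  ext v
  simp

theorem exists_isPairing_of_isMatching [Fintype V] {M : G.Subgraph} (hM : M.IsMatching) :
    ∃ f, IsPairing G f M.verts.toFinset := by
  have h1 : ∀ v, ∃ w, v ∈ M.verts → M.Adj v w := fun v => by
    by_cases hv : v ∈ M.verts
    · obtain ⟨w, hw, -⟩ := hM hv
      exact ⟨w, fun _ => hw⟩
    · exact ⟨v, fun h => absurd h hv⟩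
  choose f hf using h1
  refine ⟨f, fun u hu => ?_⟩
  rw [Set.mem_toFinset] at hu
  have h2 := hf u hu
  have h3 : f u ∈ M.verts := M.edge_vert h2.symm
  exact ⟨Set.mem_toFinset.mpr h3, M.adj_sub h2, hM.eq_of_adj_left (hf _ h3) h2.symm⟩

theorem nonempty_matchedSets [Fintype V] {n : ℕ} (hn : 0 < n) (hnm : n ≤ matchingNumber G) :
    (matchedSets G n).Nonempty := by
  set S := {m | ∃ M : G.Subgraph, M.IsMatching ∧ M.edgeSet.ncard = m} with hS
  -- The supremum of the empty set is 0, so `0 < n` already excludes emptiness.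
  have hne : S.Nonempty := by
    by_contra h
    rw [Set.not_nonempty_iff_eq_empty] at h
    rw [matchingNumber, ← hS, h] at hnm
    simp at hnm
    omega
  have hb : BddAbove S := by
    refine ⟨(Set.univ : Set (Sym2 V)).ncard, ?_⟩
    rintro _ ⟨M, -, rfl⟩
    exact Set.ncard_le_ncard (Set.subset_univ _)
  obtain ⟨M, hM, hcard⟩ := Nat.sSup_mem hne hb
  obtain ⟨f, hf⟩ := exists_isPairing_of_isMatching hM
  have h1 := card_verts_of_isMatching hM
  rw [hcard, Set.ncard_eq_toFinset_card'] at h1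
  obtain ⟨U, hU, hUc⟩ := hf.exists_subset h1 hnm
  exact ⟨U, hUc, f, hU⟩

theorem IsPairing.exists_isPerfectMatching [Fintype V] {f : V → V} {n : ℕ}
    (hf : IsPairing G f Finset.univ) (hn : Fintype.card V = 2 * n) :
    ∃ M : G.Subgraph, M.IsPerfectMatching ∧ M.edgeSet.ncard = n := by
  have hf' := fun u => hf u (Finset.mem_univ u)
  let M : G.Subgraph :=
    { verts := Set.univ
      Adj := fun a b => f a = b
      adj_sub := fun {a b} h => h ▸ (hf' a).2.1
      edge_vert := fun _ => trivial
      symm := ⟨fun a b h => h ▸ (hf' a).2.2⟩ }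
  have hM : M.IsPerfectMatching := by
    rw [SimpleGraph.Subgraph.isPerfectMatching_iff]
    exact fun v => ⟨f v, rfl, fun _ h => Eq.symm h⟩
  have h1 := card_verts_of_isMatching hM.1
  refine ⟨M, hM, ?_⟩
  have h2 : M.verts.ncard = Fintype.card V := by
    rw [← Nat.card_eq_fintype_card]
    exact Set.ncard_univ V
  omega

/-! ### Minimal generators of squarefree powers -/

/-- The exponent vector of the product of the variables in `U`. -/
def indicator (U : Finset V) : V →₀ ℕ :=
  Finsupp.indicator U fun _ _ => 1

theorem indicator_apply (U : Finset V) (v : V) : indicator U v = if v ∈ U then 1 else 0 := by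
  simp [indicator, Finsupp.indicator_apply]

theorem indicator_le_iff {U U' : Finset V} : indicator U ≤ indicator U' ↔ U ⊆ U' := by
  rw [Finsupp.le_def]
  simp only [indicator_apply]
  refine forall_congr' fun v => ?_
  split_ifs <;> simp_all

theorem indicator_injective : Function.Injective (indicator : Finset V → V →₀ ℕ) := fun _ _ h =>
  Finset.Subset.antisymm (indicator_le_iff.mp h.le) (indicator_le_iff.mp h.ge)

theorem indicator_union (U U' : Finset V) :
    indicator (U ∪ U') = indicator U ⊔ indicator U' := by
  ext v
  simp only [indicator_apply, Finsupp.sup_apply, Finset.mem_union]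
  split_ifs <;> simp_all

variable (G) in
/-- The exponent vectors of the products of `n` edges. -/
def edgeProducts : ℕ → Set (V →₀ ℕ)
  | 0 => {0}
  | n + 1 => {e | ∃ v w, G.Adj v w ∧ ∃ e' ∈ edgeProducts n,
      e = e' + (Finsupp.single v 1 + Finsupp.single w 1)}

theorem edgeIdeal_pow (n : ℕ) :
    edgeIdeal k G ^ n = Ideal.span ((fun a => monomial a (1 : k)) '' edgeProducts G n) := by
  induction n with
  | zero => simp [edgeProducts]
  | succ n ih =>
    rw [pow_succ, ih, edgeIdeal, Ideal.span_mul_span']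
    congr 1
    ext p
    simp only [Set.mem_mul, Set.mem_image, Set.mem_ofPred_eq, edgeProducts]
    constructor
    · rintro ⟨_, ⟨e, he, rfl⟩, _, ⟨v, w, hvw, rfl⟩, rfl⟩
      exact ⟨_, ⟨v, w, hvw, e, he, rfl⟩, by simp [X, monomial_mul]⟩
    · rintro ⟨_, ⟨v, w, hvw, e, he, rfl⟩, rfl⟩
      exact ⟨_, ⟨e, he, rfl⟩, _, ⟨v, w, hvw, rfl⟩, by simp [X, monomial_mul]⟩

/-- A repeated vertex would give an exponent of at least two, so the edges of a squarefree product
are disjoint. -/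
theorem exists_matchedSet_of_mem_edgeProducts {n : ℕ} {e : V →₀ ℕ} (he : e ∈ edgeProducts G n)
    (hsq : ∀ v, e v ≤ 1) : ∃ U ∈ matchedSets G n, indicator U = e := by
  induction n generalizing e with
  | zero =>
    refine ⟨∅, ⟨rfl, id, by simp [IsPairing]⟩, ?_⟩
    rw [show e = 0 from he]
    ext v
    simp [indicator_apply]
  | succ n ih =>
    obtain ⟨v, w, hvw, e', he', rfl⟩ := he
    have hsq' : ∀ u, e' u ≤ 1 := fun u => le_trans (by simp) (hsq u)
    obtain ⟨U, ⟨hc, f, hf⟩, rfl⟩ := ih he' hsq'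
    have hne := hvw.ne
    have hv : v ∉ U := fun h => by
      have := hsq v
      simp [indicator_apply, h] at this
    have hw : w ∉ U := fun h => by
      have := hsq w
      simp [indicator_apply, h] at this
    refine ⟨insert v (insert w U), ⟨?_, _, hf.insert_pair hv hw hvw⟩, ?_⟩
    · rw [Finset.card_insert_of_notMem (by simp [hne, hv]), Finset.card_insert_of_notMem hw, hc]
      ring
    · ext u
      simp only [indicator_apply, Finsupp.add_apply, Finsupp.single_apply, Finset.mem_insert]
      grind

theorem indicator_mem_edgeProducts {n : ℕ} {U : Finset V} (hU : U ∈ matchedSets G n) :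
    indicator U ∈ edgeProducts G n := by
  obtain ⟨hc, f, hf⟩ := hU
  induction n generalizing U with
  | zero =>
    rw [show U = ∅ from Finset.card_eq_zero.mp (by omega)]
    change indicator ∅ = 0
    ext v
    simp [indicator_apply]
  | succ n ih =>
    obtain ⟨u, hu⟩ : U.Nonempty := Finset.card_pos.mp (by omega)
    have h1 := hf.card_erase_pair hu
    refine ⟨u, f u, (hf u hu).2.1, _, ih (by omega) (hf.erase_pair hu), ?_⟩
    have h2 := hf.ne hu
    have h3 := (hf u hu).1
    ext v
    simp only [indicator_apply, Finsupp.add_apply, Finsupp.single_apply, Finset.mem_erase]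
    grind

/-- A squarefree monomial in the `n`-th power is divisible by a product of `n` edges, which is then
squarefree itself and comes from a matching. -/
theorem squarefreePower_eq_span (n : ℕ) : squarefreePower k G n = Ideal.span
    ((fun a => monomial a (1 : k)) '' (indicator '' matchedSets G n)) := by
  apply le_antisymm
  · rw [squarefreePower, Ideal.span_le]
    rintro _ ⟨a, hsq, ha, rfl⟩
    rw [edgeIdeal_pow] at ha
    obtain ⟨e, he, hea⟩ := mem_ideal_span_monomial_image.mp ha a (by simp)
    obtain ⟨U, hU, rfl⟩ := exists_matchedSet_of_mem_edgeProducts he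
      fun v => (hea v).trans (hsq v)
    rw [SetLike.mem_coe, mem_ideal_span_monomial_image]
    intro b hb
    rw [support_monomial, if_neg one_ne_zero, Finset.mem_singleton] at hb
    exact ⟨_, ⟨U, hU, rfl⟩, hb ▸ hea⟩
  · rw [Ideal.span_le]
    rintro _ ⟨_, ⟨U, hU, rfl⟩, rfl⟩
    refine Ideal.subset_span ⟨indicator U, fun v => ?_, ?_, rfl⟩
    · rw [indicator_apply]
      split_ifs <;> simp
    · rw [edgeIdeal_pow]
      exact Ideal.subset_span ⟨_, indicator_mem_edgeProducts hU, rfl⟩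

theorem eq_of_subset_of_mem_matchedSets {n : ℕ} {U U' : Finset V} (hU : U ∈ matchedSets G n)
    (hU' : U' ∈ matchedSets G n) (h : U ⊆ U') : U = U' :=
  Finset.eq_of_subset_of_card_le h (by rw [hU.1, hU'.1])

/-- All these generators have degree `2n`, so none properly divides another. -/
theorem mingens_squarefreePower (n : ℕ) :
    mingens (squarefreePower k G n) = indicator '' matchedSets G n := by
  have hmem : ∀ b : V →₀ ℕ, monomial b (1 : k) ∈ squarefreePower k G n ↔
      ∃ U ∈ matchedSets G n, indicator U ≤ b := by
    intro b
    rw [squarefreePower_eq_span, mem_ideal_span_monomial_image]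
    simp
  have hmin : ∀ b : V →₀ ℕ, b ∈ mingens (squarefreePower k G n) ↔
      Minimal (fun b => ∃ U ∈ matchedSets G n, indicator U ≤ b) b := by
    intro b
    change Minimal (fun b : V →₀ ℕ => monomial b (1 : k) ∈ squarefreePower k G n) b ↔ _
    simp only [hmem]
  ext b
  rw [hmin]
  constructor
  · intro h
    obtain ⟨U, hU, hle⟩ := h.prop
    exact ⟨U, hU, h.eq_of_le ⟨U, hU, le_rfl⟩ hle⟩
  · rintro ⟨U, hU, rfl⟩
    refine ⟨⟨U, hU, le_rfl⟩, ?_⟩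
    rintro c ⟨U', hU', hle⟩ hc
    rw [← eq_of_subset_of_mem_matchedSets hU' hU (indicator_le_iff.mp (hle.trans hc))]
    exact hle

variable {n : ℕ}

/-! ### Scarf faces of squarefree powers -/

theorem indicator_mem_mingens {U : Finset V} (hU : U ∈ matchedSets G n) :
    indicator U ∈ mingens (squarefreePower k G n) := by
  rw [mingens_squarefreePower]
  exact ⟨U, hU, rfl⟩

theorem mem_taylorFaces_iff {I : Ideal (MvPolynomial V k)} {σ : Finset (V →₀ ℕ)} :
    σ ∈ taylorFaces I ↔ ∀ a ∈ σ, a ∈ mingens I := Iff.rfl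

theorem eq_of_mem_mingens_of_le {I : Ideal (MvPolynomial V k)} {a b : V →₀ ℕ}
    (ha : a ∈ mingens I) (hb : b ∈ mingens I) (h : a ≤ b) : a = b :=
  (Minimal.eq_of_le (P := fun b : V →₀ ℕ => monomial b (1 : k) ∈ I) hb
    (monomial_mem_of_mem_mingens ha) h)

/-- A face with label `a ⊔ b` can only use `a` and `b`, and needs both because distinct minimal
generators are incomparable. -/
theorem pair_mem_scarfFaces {I : Ideal (MvPolynomial V k)} {a b : V →₀ ℕ} (ha : a ∈ mingens I)
    (hb : b ∈ mingens I) (hab : a ≠ b) (h : ∀ c ∈ mingens I, c ≤ a ⊔ b → c = a ∨ c = b) :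
    {a, b} ∈ scarfFaces I := by
  refine ⟨mem_taylorFaces_iff.mpr (by simp [ha, hb]), fun τ hτ hl => ?_⟩
  have hl' : label τ = a ⊔ b := by simp [hl]
  have hsub : ∀ c ∈ τ, c = a ∨ c = b := fun c hc => h c (hτ hc) (hl' ▸ le_label hc)
  have ha' : a ∈ τ := by
    by_contra hn
    have h1 : label τ ≤ b := label_le_iff.mpr fun c hc => by
      rcases hsub c hc with rfl | rfl
      · exact absurd hc hn
      · exact le_rfl
    rw [hl'] at h1
    exact hab (eq_of_mem_mingens_of_le ha hb (le_sup_left.trans h1))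
  have hb' : b ∈ τ := by
    by_contra hn
    have h1 : label τ ≤ a := label_le_iff.mpr fun c hc => by
      rcases hsub c hc with rfl | rfl
      · exact le_rfl
      · exact absurd hc hn
    rw [hl'] at h1
    exact hab (eq_of_mem_mingens_of_le hb ha (le_sup_right.trans h1)).symm
  ext c
  simp only [Finset.mem_insert, Finset.mem_singleton]
  exact ⟨hsub c, by rintro (rfl | rfl) <;> assumption⟩

theorem singleton_mem_scarfFaces {I : Ideal (MvPolynomial V k)} {a : V →₀ ℕ} (ha : a ∈ mingens I)
    (h0 : a ≠ 0) : {a} ∈ scarfFaces I := by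
  refine ⟨mem_taylorFaces_iff.mpr (by simp [ha]), fun τ hτ hl => ?_⟩
  rw [label_singleton] at hl
  have hsub : ∀ c ∈ τ, c = a := fun c hc =>
    eq_of_mem_mingens_of_le (hτ hc) ha (hl ▸ le_label hc)
  obtain ⟨c, hc⟩ : τ.Nonempty := by
    by_contra hn
    rw [Finset.not_nonempty_iff_eq_empty] at hn
    rw [hn, label_empty] at hl
    exact h0 hl.symm
  ext b
  rw [Finset.mem_singleton]
  exact ⟨hsub b, fun h => by rwa [h, ← hsub c hc]⟩

theorem indicator_ne_zero {U : Finset V} (h : U.Nonempty) : indicator U ≠ 0 := by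
  obtain ⟨u, hu⟩ := h
  intro h
  have := DFunLike.congr_fun h u
  simp [indicator_apply, hu] at this

/-- Two generators whose label is `W` do not span a Scarf face if there is a third generator below
`W`. -/
theorem pair_notMem_scarfFaces {W U U' U₁ U₂ U₃ : Finset V} (h : U ∪ U' = W)
    (h₁ : U₁ ∈ matchedSets G n) (h₂ : U₂ ∈ matchedSets G n) (h₃ : U₃ ∈ matchedSets G n)
    (h₁₂ : U₁ ≠ U₂) (h₁₃ : U₁ ≠ U₃) (h₂₃ : U₂ ≠ U₃) (hW₁ : U₁ ⊆ W) (hW₂ : U₂ ⊆ W)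
    (hW₃ : U₃ ⊆ W) :
    {indicator U, indicator U'} ∉ scarfFaces (squarefreePower k G n) := by
  intro hσ
  let τ : Finset (V →₀ ℕ) := {indicator U₁, indicator U₂, indicator U₃}
  have hτ : τ.card = 3 := Finset.card_eq_three.mpr ⟨_, _, _, indicator_injective.ne h₁₂,
    indicator_injective.ne h₁₃, indicator_injective.ne h₂₃, rfl⟩
  have hl : label τ ≤ indicator W := label_le_iff.mpr (by
    simp [τ, indicator_le_iff, hW₁, hW₂, hW₃])
  -- Adjoining the three generators keeps the label `W`, so they would all belong to a two-element
  -- face.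
  have h1 := hσ.2 (τ ∪ {indicator U, indicator U'}) (by
    rw [mem_taylorFaces_iff]
    intro a ha
    rcases Finset.mem_union.mp ha with ha | ha
    · simp only [τ, Finset.mem_insert, Finset.mem_singleton] at ha
      rcases ha with rfl | rfl | rfl <;> apply indicator_mem_mingens <;> assumption
    · exact hσ.1 ha) (by
    have : label {indicator U, indicator U'} = indicator W := by
      simp [← h, indicator_union]
    rw [this]
    apply le_antisymm
    · rw [label, Finset.sup_union]
      exact sup_le hl this.le
    · rw [← this]
      exact label_mono Finset.subset_union_right)
  have h2 := Finset.card_le_card (Finset.subset_union_left.trans h1.subset)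
  have h3 := Finset.card_le_two (a := indicator U) (b := indicator U')
  omega

/-! ### Restrictions on the graph from exactness -/

section Exact

variable (hex : Function.Exact (boundary k (scarfFaces (squarefreePower k G n)) 1)
  (boundary k (scarfFaces (squarefreePower k G n)) 0))

include hex

theorem exists_scarf_edge (hn : 0 < n) {W U U' : Finset V} (hU : U ∈ matchedSets G n)
    (hU' : U' ∈ matchedSets G n) (hW : U ⊆ W) (hW' : U' ⊆ W) (P : Finset V → Prop)
    (hP : P U) (hP' : ¬ P U') :
    ∃ C ∈ matchedSets G n, ∃ D ∈ matchedSets G n,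
      {indicator C, indicator D} ∈ scarfFaces (squarefreePower k G n) ∧ C ⊆ W ∧ D ⊆ W ∧
      P C ∧ ¬ P D := by
  have hs : ∀ U ∈ matchedSets G n, {indicator U} ∈ scarfFaces (squarefreePower k G n) :=
    fun U hU => singleton_mem_scarfFaces (indicator_mem_mingens hU)
      (indicator_ne_zero (Finset.card_pos.mp (by rw [hU.1]; omega)))
  obtain ⟨c, d, hcd, hc, hd, hPc, hPd⟩ := exists_edge_of_exact hex (hs U hU) (hs U' hU')
    (indicator_le_iff.mpr hW) (indicator_le_iff.mpr hW') (fun a => ∃ U, a = indicator U ∧ P U)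
    ⟨U, rfl, hP⟩ (by
      rintro ⟨U'', h, hP''⟩
      exact hP' (indicator_injective h ▸ hP''))
  have hc' : c ∈ mingens (squarefreePower k G n) := hcd.1 (by simp)
  have hd' : d ∈ mingens (squarefreePower k G n) := hcd.1 (by simp)
  rw [mingens_squarefreePower] at hc' hd'
  obtain ⟨C, hC, rfl⟩ := hc'
  obtain ⟨D, hD, rfl⟩ := hd'
  obtain ⟨C', hCC, hPC⟩ := hPc
  exact ⟨C, hC, D, hD, hcd, indicator_le_iff.mp hc, indicator_le_iff.mp hd,
    indicator_injective hCC ▸ hPC, fun h => hPd ⟨D, rfl, h⟩⟩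

/-- At most two generators lie below a given set of `2 * n + 1` variables. -/
theorem not_three_erase (hn : 0 < n) {W : Finset V} (hW : W.card = 2 * n + 1) {x y z : V}
    (hx : x ∈ W) (hy : y ∈ W) (hz : z ∈ W) (hxy : x ≠ y) (hxz : x ≠ z) (hyz : y ≠ z)
    (hWx : ∃ f, IsPairing G f (W.erase x)) (hWy : ∃ f, IsPairing G f (W.erase y))
    (hWz : ∃ f, IsPairing G f (W.erase z)) : False := by
  have hm : ∀ u ∈ W, (∃ f, IsPairing G f (W.erase u)) → W.erase u ∈ matchedSets G n :=
    fun u hu h => ⟨by rw [Finset.card_erase_of_mem hu, hW]; rfl, h⟩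
  have hne : ∀ u ∈ W, ∀ v, u ≠ v → W.erase u ≠ W.erase v := fun u hu v huv h => by
    have : u ∈ W.erase u := h ▸ Finset.mem_erase.mpr ⟨huv, hu⟩
    simp at this
  have hmx := hm x hx hWx
  have hmy := hm y hy hWy
  have hmz := hm z hz hWz
  obtain ⟨C, hC, D, hD, hCD, hCW, hDW, hPC, hPD⟩ := exists_scarf_edge hex hn hmx hmy
    (Finset.erase_subset _ _) (Finset.erase_subset _ _) (· = W.erase x) rfl
    (hne x hx y hxy).symm
  -- Two distinct `2n`-subsets of a set with `2n + 1` elements cover it.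
  have hU : C ∪ D = W := by
    apply Finset.eq_of_subset_of_card_le (Finset.union_subset hCW hDW)
    by_contra hlt
    have h1 : C.card ≤ (C ∪ D).card := Finset.card_le_card Finset.subset_union_left
    have h2 : C = C ∪ D := Finset.eq_of_subset_of_card_le Finset.subset_union_left (by
      rw [hC.1]; omega)
    have h3 := eq_of_subset_of_mem_matchedSets hD hC (h2 ▸ Finset.subset_union_right)
    exact hPD (h3 ▸ hPC)
  exact pair_notMem_scarfFaces hU hmx hmy hmz (hne x hx y hxy) (hne x hx z hxz) (hne y hy z hyz)
    (Finset.erase_subset _ _) (Finset.erase_subset _ _) (Finset.erase_subset _ _) hCD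

/-- A vertex outside a matching has at most one neighbour in it. -/
theorem eq_of_adj_of_adj (hn : 0 < n) {U : Finset V} (hU : U.card = 2 * n) {f : V → V}
    (hf : IsPairing G f U) {v p q : V} (hv : v ∉ U) (hp : p ∈ U) (hq : q ∈ U) (hvp : G.Adj v p)
    (hvq : G.Adj v q) : p = q := by
  by_contra hpq
  have hne : ∀ w ∈ U, v ≠ w := fun w hw h => hv (h ▸ hw)
  -- The original matching and the two exchanges at `p` and `q` omit `v`, `f p` and `f q`
  -- respectively.
  refine not_three_erase hex hn (W := insert v U) (x := v) (y := f p) (z := f q)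
    (by rw [Finset.card_insert_of_notMem hv, hU]) (Finset.mem_insert_self _ _)
    (Finset.mem_insert_of_mem (hf p hp).1) (Finset.mem_insert_of_mem (hf q hq).1)
    (hne _ (hf p hp).1) (hne _ (hf q hq).1) (fun h => hpq ?_) ⟨f, ?_⟩
    ⟨_, hf.swap hv hp hvp⟩ ⟨_, hf.swap hv hq hvq⟩
  · rw [← (hf p hp).2.2, h, (hf q hq).2.2]
  · rwa [Finset.erase_insert hv]

/-- The subgraph induced on a matching with `n + 1` edges is connected. -/
theorem not_closed (hn : 2 ≤ n) {W A : Finset V} (hW : W.card = 2 * n + 2) {f : V → V}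
    (hf : IsPairing G f W) (hAW : A ⊆ W) (hfA : ∀ a ∈ A, f a ∈ A) (hA : A.Nonempty) (hne : A ≠ W)
    (hcl : ∀ a ∈ A, ∀ z ∈ W, G.Adj a z → z ∈ A) : False := by
  obtain ⟨a, ha⟩ := hA
  obtain ⟨b, hb, hbA⟩ : ∃ b ∈ W, b ∉ A := by
    by_contra! h
    exact hne (Finset.Subset.antisymm hAW h)
  let g : V → Finset V := fun u => (W.erase u).erase (f u)
  have hg : ∀ u ∈ W, g u ∈ matchedSets G n := fun u hu =>
    ⟨by have := hf.card_erase_pair hu; simp only [g]; omega, f, hf.erase_pair hu⟩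
  have hgW : ∀ u, g u ⊆ W := fun u =>
    (Finset.erase_subset _ _).trans (Finset.erase_subset _ _)
  have hgne : ∀ u ∈ W, ∀ v ∈ W, u ≠ v → u ≠ f v → g u ≠ g v := fun u hu v hv h1 h2 h => by
    have : u ∈ g v := by simp [g, hu, h1, h2]
    rw [← h] at this
    simp [g] at this
  have hfA' : ∀ u ∈ W, u ∉ A → f u ∉ A := fun u hu huA h => huA (by
    rw [← (hf u hu).2.2]; exact hfA _ h)
  -- Containing the complement of `A` separates the generators that drop a matching edge inside `A`
  -- from those that drop one outside.
  obtain ⟨C, hC, D, hD, hCD, hCW, hDW, hPC, hPD⟩ := exists_scarf_edge hex (by omega)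
    (hg a (hAW ha)) (hg b hb) (hgW a) (hgW b) (fun U => W \ A ⊆ U) (by
      intro u hu
      rw [Finset.mem_sdiff] at hu
      simp only [g, Finset.mem_erase]
      exact ⟨fun h => hu.2 (h ▸ hfA a ha), fun h => hu.2 (h ▸ ha), hu.1⟩) (by
      intro h
      have := h (Finset.mem_sdiff.mpr ⟨hb, hbA⟩)
      simp [g] at this)
  obtain ⟨q, hq, hqD⟩ := Finset.not_subset.mp hPD
  rw [Finset.mem_sdiff] at hq
  -- Parity: no edge of `W` leaves `A`, so `D ∩ A` is perfectly matched and even, as is `A`. Since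
  -- `D` misses just two vertices of `W`, one of them `q ∉ A`, it misses none of `A`.
  have hAD : A ⊆ D := by
    obtain ⟨hDc, h, hh⟩ := hD
    have hp : IsPairing G h (D ∩ A) := fun u hu => by
      rw [Finset.mem_inter] at hu ⊢
      have h1 := hh u hu.1
      exact ⟨⟨h1.1, hcl u hu.2 _ (hDW h1.1) h1.2.1⟩, h1.2⟩
    have hA : IsPairing G f A := fun u hu => ⟨hfA u hu, (hf u (hAW hu)).2⟩
    have e1 := hp.even_card
    have e2 := hA.even_card
    have h1 : (A \ D).card + (D ∩ A).card = A.card := by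
      rw [Finset.inter_comm]; exact Finset.card_sdiff_add_card_inter A D
    have h2 : (W \ D).card = 2 := by
      rw [Finset.card_sdiff_of_subset hDW, hW, hDc]; omega
    have h3 : insert q (A \ D) ⊆ W \ D := by
      apply Finset.insert_subset (Finset.mem_sdiff.mpr ⟨hq.1, hqD⟩)
      exact Finset.sdiff_subset_sdiff hAW subset_rfl
    have h4 := Finset.card_le_card h3
    rw [Finset.card_insert_of_notMem (by simp [hq.2]), h2] at h4
    have h5 : (A \ D).card = 0 := by grind
    exact Finset.sdiff_eq_empty_iff_subset.mp (Finset.card_eq_zero.mp h5)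
  have hU : C ∪ D = W := by
    apply Finset.Subset.antisymm (Finset.union_subset hCW hDW)
    intro u hu
    by_cases huA : u ∈ A
    · exact Finset.mem_union_right _ (hAD huA)
    · exact Finset.mem_union_left _ (hPC (Finset.mem_sdiff.mpr ⟨hu, huA⟩))
  -- Since `n ≥ 2`, there is a third matching edge, whose removal gives a third generator below `W`.
  obtain ⟨c, hc, hcab⟩ : ∃ c ∈ W, c ∉ ({a, f a, b, f b} : Finset V) := by
    by_contra! h
    have h1 := Finset.card_le_card h
    have h2 := Finset.card_le_four (a := a) (b := f a) (c := b) (d := f b)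
    omega
  simp only [Finset.mem_insert, Finset.mem_singleton, not_or] at hcab
  have hba : b ≠ a := fun h => hbA (h ▸ ha)
  have hbfa : b ≠ f a := fun h => hbA (h ▸ hfA a ha)
  exact pair_notMem_scarfFaces hU (hg a (hAW ha)) (hg b hb) (hg c hc)
    (hgne b hb a (hAW ha) hba hbfa).symm (hgne c hc a (hAW ha) hcab.1 hcab.2.1).symm
    (hgne c hc b hb hcab.2.2.1 hcab.2.2.2).symm (hgW a) (hgW b) (hgW c) hCD

/-- A path with six vertices in a matching is impossible. -/
theorem not_path (hn : 0 < n) {W : Finset V} (hW : W.card = 2 * n + 2) {f : V → V}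
    (hf : IsPairing G f W) {p q z : V} (hp : p ∈ W) (hq : q ∈ W) (hz : z ∈ W) (hpq : G.Adj p q)
    (hqp : q ≠ f p) (hzp : z ≠ p) (hzfp : z ≠ f p) (hzq : z ≠ q) (hzfq : z ≠ f q)
    (hqz : G.Adj (f q) z) : False := by
  have hfp := hf p hp
  have hfq := hf q hq
  have hfz := hf z hz
  have hne := hpq.ne
  have n1 := hf.ne hp
  have n2 := hf.ne hq
  have n3 := hf.ne hz
  have n4 : f q ≠ p := fun h => hqp (by rw [← h, hfq.2.2])
  have n5 : f q ≠ f p := fun h => hne (by rw [← hfp.2.2, ← h, hfq.2.2])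
  have n6 : f z ≠ p := fun h => hzfp (by rw [← h, hfz.2.2])
  have n7 : f z ≠ f p := fun h => hzp (by rw [← hfz.2.2, h, hfp.2.2])
  have n8 : f z ≠ f q := fun h => hzq (by rw [← hfz.2.2, h, hfq.2.2])
  -- Drop the end `f p` of the path `f p, p, q, f q, z, f z`. On the remaining five vertices,
  -- deleting `p`, `f q` or `f z` leaves two disjoint edges, giving three generators below a set of
  -- `2n + 1` vertices.
  have h1 := hf.erase_pair hp
  have h2 := h1.swap (v := p) (p := q) (by simp) (by simp [hq, hqp, hne.symm]) hpq
  have e1 : (W.erase p).erase (f p) = (W.erase (f p)).erase p := Finset.erase_right_comm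
  have e2 : insert p ((W.erase p).erase (f p)) = W.erase (f p) := by
    rw [e1, Finset.insert_erase (Finset.mem_erase.mpr ⟨n1.symm, hp⟩)]
  rw [e2] at h2
  have h3 := h2.swap (v := f q) (p := z) (by simp) (by simp [hz, hzfp, hzfq]) hqz
  have e3 : Function.update (Function.update f p q) q p z = f z := by
    simp [hzp, hzq]
  rw [e3, Finset.insert_erase (Finset.mem_erase.mpr ⟨n5, hfq.1⟩)] at h3
  refine not_three_erase hex hn (W := W.erase (f p)) (x := p) (y := f q) (z := f z)
    (by rw [Finset.card_erase_of_mem hfp.1, hW]; rfl) (Finset.mem_erase.mpr ⟨n1.symm, hp⟩)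
    (Finset.mem_erase.mpr ⟨n5, hfq.1⟩) (Finset.mem_erase.mpr ⟨n7, hfz.1⟩) n4.symm n6.symm n8.symm
    ⟨f, e1 ▸ h1⟩ ⟨_, h2⟩ ⟨_, h3⟩

/-- There is no matching with `n + 1` edges. -/
theorem not_isPairing (hn : 2 ≤ n) {W : Finset V} (hW : W.card = 2 * n + 2) {f : V → V}
    (hf : IsPairing G f W) : False := by
  have hn' : 0 < n := by omega
  obtain ⟨v, hv⟩ : W.Nonempty := Finset.card_pos.mp (by omega)
  -- Otherwise every matching edge would be a component of its own.
  obtain ⟨p, hp, q, hq, hpq, hqp⟩ : ∃ p ∈ W, ∃ q ∈ W, G.Adj p q ∧ q ≠ f p := by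
    by_contra! h
    refine not_closed hex hn hW hf (A := {v, f v}) ?_ ?_ ⟨v, by simp⟩ ?_ ?_
    · simp [Finset.insert_subset_iff, hv, (hf v hv).1]
    · simp [(hf v hv).2.2]
    · intro h
      have := Finset.card_le_two (a := v) (b := f v)
      rw [h] at this
      omega
    · intro a ha z hz haz
      have haW : a ∈ W := by
        simp only [Finset.mem_insert, Finset.mem_singleton] at ha
        rcases ha with rfl | rfl
        · exact hv
        · exact (hf v hv).1
      rw [h a haW z hz haz]
      simp only [Finset.mem_insert, Finset.mem_singleton] at ha ⊢
      rcases ha with rfl | rfl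
      · simp
      · simp [(hf v hv).2.2]
  have hfp := hf p hp
  have hfq := hf q hq
  have hpfq : p ≠ f q := fun h => hqp (by rw [h, hfq.2.2])
  -- Removing the edge `{p, f p}` leaves an `n`-matching avoiding `p`, which can meet at most one
  -- neighbour of `p`.
  have hdeg : ∀ p ∈ W, ∀ q ∈ W, ∀ z ∈ W, G.Adj p q → G.Adj p z → q ≠ f p → z ≠ f p → q = z := by
    intro p hp q hq z hz hpq hpz hqp hzp
    have := hf.card_erase_pair hp
    refine eq_of_adj_of_adj hex hn' (U := (W.erase p).erase (f p)) (by omega) (hf.erase_pair hp)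
      (v := p) (by simp) (by simp [hq, hqp, hpq.ne']) (by simp [hz, hzp, hpz.ne']) hpq hpz
  -- These four vertices are closed under adjacency: a further neighbour of `p` or `q` violates
  -- `hdeg`, one of `f p` or `f q` completes a path on six vertices. They are not all of `W`, as `2n
  -- + 2 ≥ 6`.
  refine not_closed hex hn hW hf (A := {p, f p, q, f q}) ?_ ?_ ⟨p, by simp⟩ ?_ ?_
  · simp [Finset.insert_subset_iff, hp, hq, hfp.1, hfq.1]
  · simp [hfp.2.2, hfq.2.2]
  · intro h
    have := Finset.card_le_four (a := p) (b := f p) (c := q) (d := f q)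
    rw [h] at this
    omega
  · intro a ha z hz haz
    by_contra hzA
    simp only [Finset.mem_insert, Finset.mem_singleton, not_or] at ha hzA
    obtain ⟨z1, z2, z3, z4⟩ := hzA
    rcases ha with rfl | rfl | rfl | rfl
    · exact z3 (hdeg _ hp _ hz _ hq haz hpq z2 hqp)
    · exact not_path hex hn' hW hf hq hp hz hpq.symm hpfq z3 z4 z1 z2 haz
    · exact z1 (hdeg _ hq _ hz _ hp haz hpq.symm z4 hpfq)
    · exact not_path hex hn' hW hf hp hq hz hpq hqp z1 z2 z3 z4 haz

theorem not_adj_of_notMem (hn : 2 ≤ n) {U : Finset V} (hU : U.card = 2 * n) {f : V → V}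
    (hf : IsPairing G f U) {v w : V} (hv : v ∉ U) (hw : w ∉ U) : ¬ G.Adj v w := fun h =>
  not_isPairing hex hn (by
    rw [Finset.card_insert_of_notMem (by simp [hv, h.ne]), Finset.card_insert_of_notMem hw, hU])
    (hf.insert_pair hv hw h)

/-- The vertices outside a matching with `n` edges are leaves. -/
theorem isLeafWithJoint_of_notMem (hn : 2 ≤ n) {U : Finset V} (hU : U.card = 2 * n) {f : V → V}
    (hf : IsPairing G f U) {v w : V} (hv : v ∉ U) (hvw : G.Adj v w) :
    w ∈ U ∧ IsLeafWithJoint G v w := by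
  have hmem : ∀ w, G.Adj v w → w ∈ U := fun w h => by
    by_contra hw
    exact not_adj_of_notMem hex hn hU hf hv hw h
  refine ⟨hmem w hvw, Set.ext fun u => ⟨fun hu => ?_, fun hu => ?_⟩⟩
  · exact eq_of_adj_of_adj hex (by omega) hU hf hv (hmem u hu) (hmem w hvw) hu hvw
  · rw [Set.mem_singleton_iff.mp hu]
    exact hvw

/-- The partner of the joint of an outer leaf is also a leaf. -/
theorem isLeafWithJoint_partner (hn : 2 ≤ n) {U : Finset V} (hU : U.card = 2 * n) {f : V → V}
    (hf : IsPairing G f U) {v w : V} (hv : v ∉ U) (hvw : G.Adj v w) :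
    IsLeafWithJoint G (f w) w := by
  obtain ⟨hw, -⟩ := isLeafWithJoint_of_notMem hex hn hU hf hv hvw
  -- After exchanging `f w` for `v`, the vertex `f w` is the one outside the matching.
  exact (isLeafWithJoint_of_notMem hex hn ((hf.card_swap hv hw).trans hU) (hf.swap hv hw hvw)
    (by simp) (hf w hw).2.1.symm).2

end Exact

theorem eq_or_eq_of_mem_pair {p q y y' t : V} (hy : y = p ∨ y = q) (hy' : y' = p ∨ y' = q)
    (hne : y ≠ y') (ht : t = p ∨ t = q) : t = y ∨ t = y' := by
  grind

/-- The generators below a set of `2 * n + 2` variables do not form a square. -/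
theorem not_square (hex : Function.Exact (boundary k (scarfFaces (squarefreePower k G n)) 2)
    (boundary k (scarfFaces (squarefreePower k G n)) 1)) {W : Finset V} {a b c d : V}
    (ha : a ∈ W) (hb : b ∈ W) (hc : c ∈ W) (hd : d ∈ W) (hab : a ≠ b) (hac : a ≠ c) (had : a ≠ d)
    (hbc : b ≠ c) (hbd : b ≠ d) (hcd : c ≠ d)
    (h : ∀ D, D ∈ matchedSets G n ∧ D ⊆ W ↔
      ∃ x y, (x = a ∨ x = b) ∧ (y = c ∨ y = d) ∧ D = (W.erase x).erase y) : False := by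
  let S : V → V → V →₀ ℕ := fun x y => indicator ((W.erase x).erase y)
  have hSm : ∀ x y, (x = a ∨ x = b) → (y = c ∨ y = d) →
      S x y ∈ mingens (squarefreePower k G n) := fun x y hx hy =>
    indicator_mem_mingens ((h _).mpr ⟨x, y, hx, hy, rfl⟩).1
  have hSW : ∀ x y, S x y ≤ indicator W := fun x y => indicator_le_iff.mpr
    ((Finset.erase_subset _ _).trans (Finset.erase_subset _ _))
  have hS0 : ∀ x y u, S x y u = if u ∈ W ∧ u ≠ x ∧ u ≠ y then 1 else 0 := fun x y u => by
    simp only [S, indicator_apply, Finset.mem_erase]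
    congr 1
    apply propext
    tauto
  have hgen : ∀ e ∈ mingens (squarefreePower k G n), e ≤ indicator W →
      ∃ x y, (x = a ∨ x = b) ∧ (y = c ∨ y = d) ∧ e = S x y := by
    intro e he heW
    rw [mingens_squarefreePower] at he
    obtain ⟨D, hD, rfl⟩ := he
    obtain ⟨x, y, hx, hy, rfl⟩ := (h D).mp ⟨hD, indicator_le_iff.mp heW⟩
    exact ⟨x, y, hx, hy, rfl⟩
  have hmiss : ∀ e ∈ mingens (squarefreePower k G n), e ≤ indicator W → ∀ u ∈ W, e u = 0 →
      ∃ x y, (x = a ∨ x = b) ∧ (y = c ∨ y = d) ∧ e = S x y ∧ (u = x ∨ u = y) := by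
    intro e he heW u hu h0
    obtain ⟨x, y, hx, hy, rfl⟩ := hgen e he heW
    refine ⟨x, y, hx, hy, rfl, ?_⟩
    rw [hS0] at h0
    by_contra! h1
    rw [if_pos ⟨hu, h1⟩] at h0
    exact one_ne_zero h0
  have hxy : ∀ x y, (x = a ∨ x = b) → (y = c ∨ y = d) → x ≠ y := by
    rintro x y (rfl | rfl) (rfl | rfl) <;> assumption
  have hxW : ∀ x, (x = a ∨ x = b) → x ∈ W := by rintro x (rfl | rfl) <;> assumption
  have hyW : ∀ y, (y = c ∨ y = d) → y ∈ W := by rintro y (rfl | rfl) <;> assumption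
  have hne : ∀ x y x' y', (x = a ∨ x = b) → (y = c ∨ y = d) → (x' = a ∨ x' = b) →
      (y' = c ∨ y' = d) → S x y = S x' y' → x = x' ∧ y = y' := by
    intro x y x' y' hx hy hx' hy' heq
    have h1 := DFunLike.congr_fun heq x
    have h2 := DFunLike.congr_fun heq y
    simp only [hS0, hxW x hx, hyW y hy] at h1 h2
    refine ⟨by_contra fun h => ?_, by_contra fun h => ?_⟩
    · exact hxy x y' hx hy' (by simpa [h] using h1)
    · exact hxy x' y hx' hy (by simpa [h, eq_comm] using h2)
  -- The lcm of two adjacent corners misses their common deleted vertex, and no other corner misses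
  -- it.
  have edge : ∀ x y x' y', (x = a ∨ x = b) → (y = c ∨ y = d) → (x' = a ∨ x' = b) →
      (y' = c ∨ y' = d) → (x = x' ∧ y ≠ y' ∨ x ≠ x' ∧ y = y') →
      {S x y, S x' y'} ∈ scarfFaces (squarefreePower k G n) := by
    intro x y x' y' hx hy hx' hy' hor
    refine pair_mem_scarfFaces (hSm x y hx hy) (hSm x' y' hx' hy')
      (fun heq => by
        obtain ⟨rfl, rfl⟩ := hne x y x' y' hx hy hx' hy' heq
        simp at hor) fun e he hle => ?_
    have heW := hle.trans (sup_le (hSW x y) (hSW x' y'))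
    rcases hor with ⟨rfl, hyy⟩ | ⟨hxx, rfl⟩
    · have h0 : e x = 0 := by
        have := hle x
        rw [Finsupp.sup_apply, hS0, hS0] at this
        simpa using this
      obtain ⟨s, t, hs, ht, rfl, hst⟩ := hmiss e he heW x (hxW x hx) h0
      obtain rfl : x = s := hst.resolve_right (hxy x t hx ht)
      rcases eq_or_eq_of_mem_pair hy hy' hyy ht with rfl | rfl <;> simp
    · have h0 : e y = 0 := by
        have := hle y
        rw [Finsupp.sup_apply, hS0, hS0] at this
        simpa using this
      obtain ⟨s, t, hs, ht, rfl, hst⟩ := hmiss e he heW y (hyW y hy) h0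
      obtain rfl : y = t := hst.resolve_left (hxy s y hs hy).symm
      rcases eq_or_eq_of_mem_pair hx hx' hxx hs with rfl | rfl <;> simp
  have hSne : ∀ x y x' y', (x = a ∨ x = b) → (y = c ∨ y = d) → (x' = a ∨ x' = b) →
      (y' = c ∨ y' = d) → (x ≠ x' ∨ y ≠ y') → S x y ≠ S x' y' := by
    intro x y x' y' hx hy hx' hy' hor heq
    obtain ⟨rfl, rfl⟩ := hne x y x' y' hx hy hx' hy' heq
    simp at hor
  obtain ⟨σ, hσ, hc3, hl⟩ := exists_triangle_of_exact hex (W := indicator W)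
    (a := S a c) (b := S b c) (c := S b d) (d := S a d)
    (edge _ _ _ _ (by simp) (by simp) (by simp) (by simp) (by simp [hab]))
    (edge _ _ _ _ (by simp) (by simp) (by simp) (by simp) (by simp [hcd]))
    (edge _ _ _ _ (by simp) (by simp) (by simp) (by simp) (by simp [hab.symm]))
    (edge _ _ _ _ (by simp) (by simp) (by simp) (by simp) (by simp [hcd.symm]))
    (hSW _ _) (hSW _ _) (hSW _ _) (hSW _ _)
    (hSne _ _ _ _ (by simp) (by simp) (by simp) (by simp) (by simp [hab]))
    (hSne _ _ _ _ (by simp) (by simp) (by simp) (by simp) (by simp [hcd]))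
    (hSne _ _ _ _ (by simp) (by simp) (by simp) (by simp) (by simp [hab.symm]))
    (hSne _ _ _ _ (by simp) (by simp) (by simp) (by simp) (by simp [hcd.symm]))
    (hSne _ _ _ _ (by simp) (by simp) (by simp) (by simp) (by simp [hab]))
    (hSne _ _ _ _ (by simp) (by simp) (by simp) (by simp) (by simp [hab.symm]))
  have hσW := label_le_iff.mp hl
  -- A vertex of `W` missing from the label is deleted by all three corners of `σ`, but only two
  -- corners delete a given vertex.
  have hlW : label σ = indicator W := by
    refine le_antisymm hl fun u => ?_
    rw [indicator_apply]
    split_ifs with hu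
    swap
    · exact Nat.zero_le _
    by_contra hlt
    have h0 : ∀ e ∈ σ, e u = 0 := fun e he => by
      have := le_label he u
      omega
    have key : ∀ e₁ e₂, (∀ e ∈ σ, e = e₁ ∨ e = e₂) → False := fun e₁ e₂ h2 => by
      have h3 : σ ⊆ {e₁, e₂} := fun e he => by simpa using h2 e he
      have h4 := Finset.card_le_card h3
      have h5 := Finset.card_le_two (a := e₁) (b := e₂)
      omega
    have hm : ∀ e ∈ σ, ∃ x y, (x = a ∨ x = b) ∧ (y = c ∨ y = d) ∧ e = S x y ∧ (u = x ∨ u = y) :=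
      fun e he => hmiss e (hσ.1 he) (hσW e he) u hu (h0 e he)
    by_cases hua : u = a ∨ u = b
    · refine key (S u c) (S u d) fun e he => ?_
      obtain ⟨x, y, hx, hy, rfl, hu'⟩ := hm e he
      obtain rfl : u = x := hu'.resolve_right (hxy u y hua hy)
      rcases hy with rfl | rfl <;> simp
    · refine key (S a u) (S b u) fun e he => ?_
      obtain ⟨x, y, hx, hy, rfl, hu'⟩ := hm e he
      obtain rfl : u = y := hu'.resolve_left fun h => hua (h ▸ hx)
      rcases hx with rfl | rfl <;> simp
  -- All four corners divide the label `W` of the Scarf triangle, so it would have to contain them.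
  let τ : Finset (V →₀ ℕ) := insert (S a c) (insert (S b c) (insert (S b d) (insert (S a d) σ)))
  have h1 : τ = σ := by
    refine hσ.2 τ (mem_taylorFaces_iff.mpr fun e he => ?_) ?_
    · simp only [τ, Finset.mem_insert] at he
      rcases he with rfl | rfl | rfl | rfl | he
      · exact hSm _ _ (by simp) (by simp)
      · exact hSm _ _ (by simp) (by simp)
      · exact hSm _ _ (by simp) (by simp)
      · exact hSm _ _ (by simp) (by simp)
      · exact hσ.1 he
    · rw [hlW]
      refine le_antisymm (label_le_iff.mpr fun e he => ?_) ?_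
      · simp only [τ, Finset.mem_insert] at he
        rcases he with rfl | rfl | rfl | rfl | he
        · exact hSW _ _
        · exact hSW _ _
        · exact hSW _ _
        · exact hSW _ _
        · exact hσW e he
      · rw [← hlW]
        exact label_mono fun e he => by simp [τ, he]
  have h2 : ({S a c, S b c, S b d, S a d} : Finset (V →₀ ℕ)) ⊆ σ := by
    rw [← h1]
    intro e he
    simp only [Finset.mem_insert, Finset.mem_singleton, τ] at he ⊢
    tauto
  have h3 : ({S a c, S b c, S b d, S a d} : Finset (V →₀ ℕ)).card = 4 := by
    rw [Finset.card_eq_four]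
    refine ⟨_, _, _, _, ?_, ?_, ?_, ?_, ?_, ?_, rfl⟩ <;>
      refine hSne _ _ _ _ (by simp) (by simp) (by simp) (by simp) ?_ <;>
      simp [hab, hcd, hab.symm]
  have h4 := Finset.card_le_card h2
  omega

/-- All vertices outside a matching with `n` edges have the same joint. -/
theorem joint_unique
    (hex : Function.Exact (boundary k (scarfFaces (squarefreePower k G n)) 1)
      (boundary k (scarfFaces (squarefreePower k G n)) 0))
    (hex' : Function.Exact (boundary k (scarfFaces (squarefreePower k G n)) 2)
      (boundary k (scarfFaces (squarefreePower k G n)) 1))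
    (hn : 2 ≤ n) {U : Finset V} (hU : U.card = 2 * n) {f : V → V}
    (hf : IsPairing G f U) {v w v' w' : V} (hv : v ∉ U) (hvw : G.Adj v w) (hv' : v' ∉ U)
    (hvw' : G.Adj v' w') : w = w' := by
  by_contra hne
  obtain ⟨hw, hl₁⟩ := isLeafWithJoint_of_notMem hex hn hU hf hv hvw
  obtain ⟨hw', hl₂⟩ := isLeafWithJoint_of_notMem hex hn hU hf hv' hvw'
  have hl₃ := isLeafWithJoint_partner hex hn hU hf hv hvw
  have hl₄ := isLeafWithJoint_partner hex hn hU hf hv' hvw'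
  have huniq : ∀ {x j u : V}, IsLeafWithJoint G x j → G.Adj x u → u = j := fun {x j u} hx hu => by
    have : u ∈ G.neighborSet x := hu
    rw [hx] at this
    exact this
  have hvv : v ≠ v' := fun h => hne (huniq hl₂ (h ▸ hvw))
  have hfw := hf w hw
  have hfw' := hf w' hw'
  have hne1 : ∀ u ∈ U, u ≠ v := fun u hu h => hv (h ▸ hu)
  have hne2 : ∀ u ∈ U, u ≠ v' := fun u hu h => hv' (h ▸ hu)
  have h1 := hf.swap hv hw hvw
  have hfne : f w ≠ f w' := fun h => hne (by rw [← hfw.2.2, h, hfw'.2.2])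
  -- Otherwise, after exchanging `f w` for `v`, the adjacent vertices `v'` and `f w` both lie
  -- outside an `n`-matching.
  have hwf : w' ≠ f w := by
    rintro rfl
    exact not_adj_of_notMem hex hn ((hf.card_swap hv hw).trans hU) h1 (v := v') (w := f w)
      (by simp [hvv.symm, hv']) (by simp) hvw'
  set W : Finset V := insert v (insert v' U) with hWdef
  have hvW : v ∈ W := by simp [W]
  have hv'W : v' ∈ W := by simp [W]
  have hUW : ∀ u ∈ U, u ∈ W := fun u hu => by simp [W, hu]
  have hWc : W.card = 2 * n + 2 := by
    rw [hWdef, Finset.card_insert_of_notMem (by simp [hv, hvv]), Finset.card_insert_of_notMem hv',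
      hU]
  have h2 := hf.swap hv' hw' hvw'
  have h3 := h1.swap (v := v') (p := w') (by simp [hvv.symm, hv']) (by simp [hw', hwf]) hvw'
  have e3 : Function.update (Function.update f v w) w v w' = f w' := by
    simp [Ne.symm hne, hne1 w' hw']
  rw [e3] at h3
  -- The four sets arise from the original matching, the exchange at either joint, and both
  -- exchanges together.
  have hS : ∀ x y, (x = v ∨ x = f w) → (y = v' ∨ y = f w') →
      (∃ g, IsPairing G g ((W.erase x).erase y)) ∧ ((W.erase x).erase y).card = 2 * n := by
    intro x y hx hy
    have hxW : x ∈ W := by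
      rcases hx with rfl | rfl
      · exact hvW
      · exact hUW _ hfw.1
    have hyW : y ∈ W := by
      rcases hy with rfl | rfl
      · exact hv'W
      · exact hUW _ hfw'.1
    have hxy : y ≠ x := by
      have := hne1 _ hfw'.1
      have := hne2 _ hfw.1
      grind
    refine ⟨?_, by
      rw [Finset.card_erase_of_mem (Finset.mem_erase.mpr ⟨hxy, hyW⟩),
        Finset.card_erase_of_mem hxW, hWc]; omega⟩
    have m1 := hne1 _ hfw.1
    have m2 := hne2 _ hfw.1
    have m3 := hne1 _ hfw'.1
    have m4 := hne2 _ hfw'.1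
    rcases hx with rfl | rfl <;> rcases hy with rfl | rfl
    · refine ⟨_, Eq.mp (congrArg _ ?_) hf⟩
      ext u
      simp only [W, Finset.mem_erase, Finset.mem_insert]
      clear * - hne1 hne2 hvv hfne m1 m2 m3 m4 hv hv'
      grind
    · refine ⟨_, Eq.mp (congrArg _ ?_) h2⟩
      ext u
      simp only [W, Finset.mem_erase, Finset.mem_insert]
      clear * - hne1 hne2 hvv hfne m1 m2 m3 m4 hv hv'
      grind
    · refine ⟨_, Eq.mp (congrArg _ ?_) h1⟩
      ext u
      simp only [W, Finset.mem_erase, Finset.mem_insert]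
      clear * - hne1 hne2 hvv hfne m1 m2 m3 m4 hv hv'
      grind
    · refine ⟨_, Eq.mp (congrArg _ ?_) h3⟩
      ext u
      simp only [W, Finset.mem_erase, Finset.mem_insert]
      clear * - hne1 hne2 hvv hfne m1 m2 m3 m4 hv hv'
      grind
  refine not_square hex' (W := W) (a := v) (b := f w) (c := v') (d := f w') hvW (hUW _ hfw.1)
    hv'W (hUW _ hfw'.1) (hne1 _ hfw.1).symm hvv (hne1 _ hfw'.1).symm (hne2 _ hfw.1)
    hfne (hne2 _ hfw'.1).symm fun D => ⟨?_, ?_⟩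
  · rintro ⟨⟨hDc, g, hg⟩, hDW⟩
    -- Two leaves with a common joint cannot both be matched to it.
    have hpair : ∀ x y j, IsLeafWithJoint G x j → IsLeafWithJoint G y j → x ≠ y →
        x ∉ D ∨ y ∉ D := by
      intro x y j hx hy hxy
      by_contra! h
      have hgx := hg x h.1
      have hgy := hg y h.2
      refine hxy ?_
      rw [← hgx.2.2, ← hgy.2.2, huniq hx hgx.2.1, huniq hy hgy.2.1]
    obtain ⟨x, hx, hxD⟩ : ∃ x, (x = v ∨ x = f w) ∧ x ∉ D := by
      rcases hpair _ _ _ hl₁ hl₃ (hne1 _ hfw.1).symm with h | h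
      · exact ⟨v, by simp, h⟩
      · exact ⟨f w, by simp, h⟩
    obtain ⟨y, hy, hyD⟩ : ∃ y, (y = v' ∨ y = f w') ∧ y ∉ D := by
      rcases hpair _ _ _ hl₂ hl₄ (hne2 _ hfw'.1).symm with h | h
      · exact ⟨v', by simp, h⟩
      · exact ⟨f w', by simp, h⟩
    refine ⟨x, y, hx, hy, Finset.eq_of_subset_of_card_le (fun u hu => ?_) ?_⟩
    · simp only [Finset.mem_erase]
      exact ⟨fun h => hyD (h ▸ hu), fun h => hxD (h ▸ hu), hDW hu⟩
    · rw [(hS x y hx hy).2, hDc]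
  · rintro ⟨x, y, hx, hy, rfl⟩
    obtain ⟨hg, hc⟩ := hS x y hx hy
    exact ⟨⟨hc, hg⟩, (Finset.erase_subset _ _).trans (Finset.erase_subset _ _)⟩

/-! ### Graphs whose squarefree power is Taylor -/

theorem isTaylor_squarefreePower_of_forall
    (h : ∀ U ∈ matchedSets G n, ∃ v ∈ U, ∀ U' ∈ matchedSets G n, v ∈ U' → U' = U) :
    IsTaylor (squarefreePower k G n) := by
  refine isTaylor_of_forall_exists_lt (squarefreePower_eq_span n) ?_
  rw [mingens_squarefreePower]
  rintro _ ⟨U, hU, rfl⟩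
  obtain ⟨v, hv, huniq⟩ := h U hU
  refine ⟨v, by simp [indicator_apply, hv], ?_⟩
  rintro _ ⟨U', hU', rfl⟩ hne
  have : v ∉ U' := fun h => hne (by rw [huniq U' hU' h])
  simp [indicator_apply, hv, this]

/-- The graph has exactly `2n` vertices, so there is only one generator. -/
theorem isTaylor_of_isPerfectMatching [Fintype V] (hn : 0 < n) {M : G.Subgraph}
    (hM : M.IsPerfectMatching) (hc : M.edgeSet.ncard = n) :
    IsTaylor (squarefreePower k G n) := by
  have h1 := card_verts_of_isMatching hM.1
  rw [Set.eq_univ_of_forall hM.2, Set.ncard_univ, Nat.card_eq_fintype_card, hc] at h1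
  have huniv : ∀ U ∈ matchedSets G n, U = Finset.univ := fun U hU =>
    Finset.eq_univ_of_card U (hU.1.trans h1.symm)
  refine isTaylor_squarefreePower_of_forall fun U hU => ?_
  obtain ⟨v, hv⟩ : U.Nonempty := Finset.card_pos.mp (by rw [hU.1]; omega)
  exact ⟨v, hv, fun U' hU' _ => (huniv U' hU').trans (huniv U hU).symm⟩

/-- All vertices outside `N` compete for the partner `w`, so a matching uses at most one of them. As
`N` has fewer than `2n` elements, a matched set meeting the complement in `v` must be `N ∪ {v}`, and
`v` is its private variable. -/
theorem isTaylor_of_leaves {w : V} {N : Finset V} (hN : N.card < 2 * n)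
    (hl : ∀ v, v ∉ N → IsLeafWithJoint G v w) : IsTaylor (squarefreePower k G n) := by
  have key : ∀ U ∈ matchedSets G n, ∀ v ∈ U, v ∉ N → U = insert v N := by
    rintro U ⟨hc, f, hf⟩ v hv hvN
    have hf' : ∀ u ∈ U, u ∉ N → f u = w := fun u hu huN => by
      have : f u ∈ G.neighborSet u := (hf u hu).2.1
      rw [hl u huN] at this
      exact this
    have hsub : U ⊆ insert v N := fun u hu => by
      by_contra hu'
      simp only [Finset.mem_insert, not_or] at hu'
      apply hu'.1
      rw [← (hf u hu).2.2, hf' u hu hu'.2, ← hf' v hv hvN, (hf v hv).2.2]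
    apply Finset.eq_of_subset_of_card_le hsub
    rw [Finset.card_insert_of_notMem hvN, hc]
    exact hN
  refine isTaylor_squarefreePower_of_forall fun U hU => ?_
  obtain ⟨v, hv, hvN⟩ := Finset.exists_mem_notMem_of_card_lt_card (hN.trans_eq hU.1.symm)
  exact ⟨v, hv, fun U' hU' h => (key U' hU' v h hvN).trans (key U hU v hv hvN).symm⟩

variable (G n) in
/-- All vertices outside some matching with `n` edges, and one end of one of its edges, are leaves
with the same joint. -/
def HasLeafLabelling : Prop :=
  ∃ (l : ℕ) (x : Fin (2 * n) → V) (y : Fin l → V), ∃ hn : 0 < n,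
    1 ≤ l ∧ Function.Bijective (Sum.elim x y) ∧
    (∀ i : Fin n, G.Adj (x ⟨2 * i, by omega⟩) (x ⟨2 * i + 1, by omega⟩)) ∧
    IsLeafWithJoint G (x ⟨2 * n - 1, by omega⟩) (x ⟨2 * n - 2, by omega⟩) ∧
    ∀ j, IsLeafWithJoint G (y j) (x ⟨2 * n - 2, by omega⟩)

theorem HasLeafLabelling.isTaylor (h : HasLeafLabelling G n) :
    IsTaylor (squarefreePower k G n) := by
  obtain ⟨l, x, y, hn, -, hb, -, hx, hy⟩ := h
  -- The last of the `x`'s is itself a leaf on the joint, so it is grouped with the `y`'s outside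
  -- `N`.
  let i₀ : Fin (2 * n) := ⟨2 * n - 1, by omega⟩
  refine isTaylor_of_leaves (w := x ⟨2 * n - 2, by omega⟩)
    (N := (Finset.univ.erase i₀).image x) ?_ fun v hv => ?_
  · refine Finset.card_image_le.trans_lt ?_
    rw [Finset.card_erase_of_mem (Finset.mem_univ _), Finset.card_univ, Fintype.card_fin]
    omega
  · obtain ⟨i | j, rfl⟩ := hb.2 v
    · have : i = i₀ := by
        by_contra h
        exact hv (Finset.mem_image_of_mem x (Finset.mem_erase.mpr ⟨h, Finset.mem_univ i⟩))
      rw [this]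
      exact hx
    · exact hy j

/-! ### From a Scarf resolution to the labelling -/

theorem IsPairing.hasLeafLabelling [Fintype V] {f : V → V} {U : Finset V} (hf : IsPairing G f U)
    (hU : U.card = 2 * n) {w : V} (hw : w ∈ U) (hfw : IsLeafWithJoint G (f w) w)
    (hne : U ≠ Finset.univ) (hl : ∀ v, v ∉ U → IsLeafWithJoint G v w) :
    HasLeafLabelling G n := by
  have : Nonempty V := ⟨w⟩
  have hpos : 0 < U.card := Finset.card_pos.mpr ⟨w, hw⟩
  obtain ⟨m, rfl⟩ : ∃ m, n = m + 1 := ⟨n - 1, by omega⟩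
  have hc := hf.card_erase_pair hw
  obtain ⟨x, hinj, him, hadj, hxw, hxf⟩ := hf.exists_enumeration_extend hw
    ((hf.erase_pair hw).exists_enumeration (m := m) (by omega))
  let e := Uᶜ.equivFin
  have hxU : ∀ i : Fin (2 * (m + 1)), x i ∈ U := fun i => by
    rw [← Finset.mem_coe, ← him]
    exact ⟨i, i.2, rfl⟩
  have hyU : ∀ j, (e.symm j : V) ∉ U := fun j => Finset.mem_compl.mp (e.symm j).2
  refine ⟨Uᶜ.card, fun i => x i, fun j => e.symm j, by omega, ?_, ⟨?_, ?_⟩, fun i => hadj i i.2,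
    ?_, fun j => ?_⟩
  · rw [Nat.one_le_iff_ne_zero, Ne, Finset.card_eq_zero, Finset.compl_eq_empty_iff]
    exact hne
  · refine Function.Injective.sumElim (fun i j h => Fin.ext (hinj i.2 j.2 h))
      (fun i j h => e.symm.injective (Subtype.ext h)) fun i j h => hyU j ?_
    rw [← h]
    exact hxU i
  · intro v
    by_cases hv : v ∈ U
    · rw [← Finset.mem_coe, ← him] at hv
      obtain ⟨i, hi, rfl⟩ := hv
      exact ⟨Sum.inl ⟨i, hi⟩, rfl⟩
    · exact ⟨Sum.inr (e ⟨v, Finset.mem_compl.mpr hv⟩), by simp⟩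
  · change IsLeafWithJoint G (x (2 * (m + 1) - 1)) (x (2 * (m + 1) - 2))
    rw [show 2 * (m + 1) - 1 = 2 * m + 1 by omega, show 2 * (m + 1) - 2 = 2 * m by omega, hxw, hxf]
    exact hfw
  · change IsLeafWithJoint G _ (x (2 * (m + 1) - 2))
    rw [show 2 * (m + 1) - 2 = 2 * m by omega, hxw]
    exact hl _ (hyU j)

/-- Any `n`-matching serves. If it misses a vertex, the absence of isolated vertices gives each
missed vertex a joint, and all these joints agree. -/
theorem IsScarf.graph_structure [Fintype V] (hG : ∀ v, ∃ w, G.Adj v w) (hn : 2 ≤ n)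
    (hnm : n ≤ matchingNumber G) (h : IsScarf (squarefreePower k G n)) :
    (∃ M : G.Subgraph, M.IsPerfectMatching ∧ M.edgeSet.ncard = n) ∨ HasLeafLabelling G n := by
  obtain ⟨U, hU, f, hf⟩ := nonempty_matchedSets (by omega) hnm
  by_cases hne : U = Finset.univ
  · subst hne
    exact Or.inl (hf.exists_isPerfectMatching hU)
  · obtain ⟨v, hv⟩ : ∃ v, v ∉ U := by
      by_contra! h
      exact hne (Finset.eq_univ_of_forall h)
    obtain ⟨w, hvw⟩ := hG v
    have h0 := h.exact 0
    refine Or.inr (hf.hasLeafLabelling hU (isLeafWithJoint_of_notMem h0 hn hU hf hv hvw).1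
      (isLeafWithJoint_partner h0 hn hU hf hv hvw) hne fun v' hv' => ?_)
    obtain ⟨w', hvw'⟩ := hG v'
    rw [joint_unique h0 (h.exact 1) hn hU hf hv hvw hv' hvw']
    exact (isLeafWithJoint_of_notMem h0 hn hU hf hv' hvw').2

end ScarfPowers

end

/-- The vertices `x_1, …, x_{2n}` are indexed from zero: `x_j` is `x (j - 1)`. -/
theorem theorem3p7 {V : Type*} [Finite V] (k : Type*) [Field k] (G : SimpleGraph V)
    (hG : ∀ v, ∃ w, G.Adj v w) (n : ℕ) (hn : 2 ≤ n) (hnm : n ≤ ScarfPowers.matchingNumber G) :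
    List.TFAE [
      ScarfPowers.IsScarf (ScarfPowers.squarefreePower k G n),
      ScarfPowers.IsTaylor (ScarfPowers.squarefreePower k G n),
      (∃ M : G.Subgraph, M.IsPerfectMatching ∧ M.edgeSet.ncard = n) ∨
      (∃ (l : ℕ) (x : Fin (2 * n) → V) (y : Fin l → V),
        1 ≤ l ∧ Function.Bijective (Sum.elim x y) ∧
        (∀ i : Fin n, G.Adj (x ⟨2 * i, by omega⟩) (x ⟨2 * i + 1, by omega⟩)) ∧
        ScarfPowers.IsLeafWithJoint G (x ⟨2 * n - 1, by omega⟩) (x ⟨2 * n - 2, by omega⟩) ∧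
        ∀ j, ScarfPowers.IsLeafWithJoint G (y j) (x ⟨2 * n - 2, by omega⟩))] := by
  cases nonempty_fintype V
  tfae_have 2 → 1 := ScarfPowers.IsTaylor.isScarf
  tfae_have 1 → 3 := by
    intro h
    rcases h.graph_structure hG hn hnm with hM | ⟨l, x, y, _, hlab⟩
    · exact Or.inl hM
    · exact Or.inr ⟨l, x, y, hlab⟩
  tfae_have 3 → 2 := by
    rintro (⟨M, hM, hc⟩ | ⟨l, x, y, h⟩)
    · exact ScarfPowers.isTaylor_of_isPerfectMatching (by omega) hM hc
    · exact ScarfPowers.HasLeafLabelling.isTaylor ⟨l, x, y, by omega, h⟩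
  tfae_finish
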